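/- Let $k,m$ be positive integers with $k$ even, let $\mathbb H$ be the upper half-plane, and for $(\tau,z)\in\mathbb H\times\mathbb C$ put $q=e^{2\pi i\tau}$, $\zeta=e^{2\pi i z}$. A Jacobi form of weight $k$ and index $m$ is a holomorphic function $\phi:\mathbb H\times\mathbb C\to\mathbb C$ such that $$(c\tau+d)^{-k}\,e^{2\pi i m\left(-\frac{c(z+\lambda\tau+\mu)^2}{c\tau+d}+\lambda^2\tau+2\lambda z\right)}\,\phi\!\left(\frac{a\tau+b}{c\tau+d},\frac{z+\lambda\tau+\mu}{c\tau+d}\right)=\phi(\tau,z)$$ for all $\begin{pmatrix}a&b\\c&d\end{pmatrix}\in SL_2(\mathbb Z)$ and $\lambda,\mu\in\mathbb Z$, and which has a Fourier expansion $\phi(\tau,z)=\sum_{n,r\in\mathbb Z,\ 4nm-r^2\ge 0}c(n,r)q^n\zeta^r$. It is a cusp form if moreover $c(n,r)\ne 0$ only for $4nm-r^2>0$. Denote the corresponding spaces by $J_{k,m}$ and $J_{k,m}^{cusp}$. Let $D_\tau=\frac1{2\pi i}\frac{\partial}{\partial\tau}$, $D_z=\frac1{2\pi i}\frac{\partial}{\partial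 z}$, let $E_2=1-24\sum_{n\ge1}\sigma_1(n)q^n$, and for $n=1,2$ let $J_n(\tau,z)$ be the deformed Eisenstein series, i.e. the meromorphic continuation to $z\in\mathbb C$ (holomorphic outside $\mathbb Z\tau+\mathbb Z$) of $$J_n(\tau,z)=\delta_{n,1}\frac{\zeta}{\zeta-1}+B_n-n\sum_{l,r\ge1}r^{n-1}\left(\zeta^l+(-1)^n\zeta^{-l}\right)q^{lr},\qquad |\operatorname{Im} z|<\operatorname{Im}\tau,$$ where $B_1=-\frac12$, $B_2=\frac16$. Theorem. For every $\phi\in J_{k,m}$ the Oberdieck derivative $$\mathcal O\phi=D_\tau\phi-\frac{k}{12}E_2\phi-J_1D_z\phi+mJ_2\phi,$$ defined for $\tau\in\mathbb H$ and $z\notin\mathbb Z\tau+\mathbb Z$, extends uniquely to a Jacobi form of weight $k+2$ and index $m$ on $\mathbb H\times\mathbb C$; and if $\phi\in J_{k,m}^{cusp}$, then this extension lies in $J_{k+2,m}^{cusp}$. Thus $\mathcal O$ maps $J_{k,m}$ to $J_{k+2,m}$ and $J_{k,m}^{cusp}$ to $J_{k+2,m}^{cusp}$. -/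

import Mathlib

open scoped UpperHalfPlane MatrixGroups

namespace JacobiForms

noncomputable section

/-- `e w = exp (2 π i w)`; thus `q = e τ` and `ζ = e z`. -/
def e (w : ℂ) : ℂ := Complex.exp (2 * Real.pi * Complex.I * w)

/-- The action of `((a, b; c, d), (l, u)) ∈ SL₂(ℤ) ⋉ ℤ²` on functions on `ℍ × ℂ`,
in weight `k` and index `m`. -/
def slash (k : ℤ) (m : ℕ) (φ : ℍ → ℂ → ℂ) (γ : SL(2, ℤ)) (l u : ℤ) (τ : ℍ) (z : ℂ) : ℂ :=
  ((γ 1 0 : ℂ) * τ + γ 1 1) ^ (-k) *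
    e (m * (-((γ 1 0 : ℂ) * (z + l * τ + u) ^ 2 / ((γ 1 0 : ℂ) * τ + γ 1 1))
      + (l : ℂ) ^ 2 * τ + 2 * l * z)) *
    φ (γ • τ) ((z + l * τ + u) / ((γ 1 0 : ℂ) * τ + γ 1 1))

/-- `φ` is holomorphic on `ℍ × ℂ` (as a function of two complex variables). -/
def IsHolomorphic (φ : ℍ → ℂ → ℂ) : Prop :=
  DifferentiableOn ℂ (fun p : ℂ × ℂ => φ (UpperHalfPlane.ofComplex p.1) p.2)
    {p : ℂ × ℂ | 0 < p.1.im}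

/-- `φ(τ, z) = ∑_{n, r ∈ ℤ} c(n, r) qⁿ ζʳ` (absolutely convergent) on all of `ℍ × ℂ`. -/
def HasFourierExpansion (φ : ℍ → ℂ → ℂ) (c : ℤ → ℤ → ℂ) : Prop :=
  ∀ (τ : ℍ) (z : ℂ),
    HasSum (fun p : ℤ × ℤ => c p.1 p.2 * e τ ^ p.1 * e z ^ p.2) (φ τ z)

/-- Jacobi forms of weight `k` and index `m` on the full Jacobi group. -/
structure IsJacobiForm (k : ℤ) (m : ℕ) (φ : ℍ → ℂ → ℂ) : Prop where
  holomorphic : IsHolomorphic φ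
  slash_eq : ∀ (γ : SL(2, ℤ)) (l u : ℤ), slash k m φ γ l u = φ
  fourier : ∃ c : ℤ → ℤ → ℂ, HasFourierExpansion φ c ∧
    ∀ n r : ℤ, c n r ≠ 0 → 0 ≤ 4 * n * m - r ^ 2

/-- Jacobi cusp forms of weight `k` and index `m` on the full Jacobi group. -/
structure IsJacobiCuspForm (k : ℤ) (m : ℕ) (φ : ℍ → ℂ → ℂ) : Prop extends
    IsJacobiForm k m φ where
  cuspidal : ∃ c : ℤ → ℤ → ℂ, HasFourierExpansion φ c ∧
    ∀ n r : ℤ, c n r ≠ 0 → 0 < 4 * n * m - r ^ 2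

/-- `D_τ = (2πi)⁻¹ ∂/∂τ`. -/
def Dτ (φ : ℍ → ℂ → ℂ) (τ : ℍ) (z : ℂ) : ℂ :=
  (2 * Real.pi * Complex.I)⁻¹ * deriv (fun w : ℂ => φ (UpperHalfPlane.ofComplex w) z) τ

/-- `D_z = (2πi)⁻¹ ∂/∂z`. -/
def Dz (φ : ℍ → ℂ → ℂ) (τ : ℍ) (z : ℂ) : ℂ :=
  (2 * Real.pi * Complex.I)⁻¹ * deriv (fun w : ℂ => φ τ w) z

/-- The lattice `ℤτ + ℤ`. -/
def lattice (τ : ℍ) : Set ℂ := {z : ℂ | ∃ l u : ℤ, z = l * τ + u}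

/-- The deformed Eisenstein series `J_n`, as a meromorphic function of `z ∈ ℂ` with poles in
`ℤτ + ℤ` at most. On the strip `|Im z| < Im τ` it is given by the double series
`δ_{n,1} ζ/(ζ-1) + B_n - n ∑_{k,r ≥ 1} r^{n-1} (ζ^k + (-1)^n ζ^{-k}) q^{kr}`
(see `deformedEisenstein_eq_tsum`); here the geometric series over `k` are summed, which gives the
meromorphic continuation to all `z` (the sum over `r` converges for every `z ∉ ℤτ + ℤ`). -/
def deformedEisenstein (n : ℕ) (τ : ℍ) (z : ℂ) : ℂ :=
  (if n = 1 then e z / (e z - 1) else 0) + ((bernoulli n : ℚ) : ℂ)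
    - n * ∑' r : ℕ+, (r : ℂ) ^ (n - 1) *
      (e z * e τ ^ (r : ℕ) / (1 - e z * e τ ^ (r : ℕ))
        + (-1) ^ n * ((e z)⁻¹ * e τ ^ (r : ℕ) / (1 - (e z)⁻¹ * e τ ^ (r : ℕ))))

theorem norm_e (w : ℂ) : ‖e w‖ = Real.exp (-(2 * Real.pi * w.im)) := by
  rw [e, Complex.norm_exp]
  congr 1
  simp

theorem norm_e_lt_one (τ : ℍ) : ‖e τ‖ < 1 := by
  rw [norm_e, Real.exp_lt_one_iff]
  have := mul_pos Real.two_pi_pos τ.im_pos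
  simpa using this

theorem hasSum_lambert (n : ℕ) (w q : ℂ) (hq : ‖q‖ < 1) (hw : ‖w * q‖ < 1) :
    Summable (fun p : ℕ+ × ℕ+ => (p.2 : ℂ) ^ n * (w ^ (p.1 : ℕ) * q ^ ((p.1 : ℕ) * (p.2 : ℕ)))) ∧
    Summable (fun r : ℕ+ => (r : ℂ) ^ n * (w * q ^ (r : ℕ) / (1 - w * q ^ (r : ℕ)))) ∧
    ∑' p : ℕ+ × ℕ+, (p.2 : ℂ) ^ n * (w ^ (p.1 : ℕ) * q ^ ((p.1 : ℕ) * (p.2 : ℕ))) =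
      ∑' r : ℕ+, (r : ℂ) ^ n * (w * q ^ (r : ℕ) / (1 - w * q ^ (r : ℕ))) := by
  have key : ∀ k r : ℕ+, ‖(r : ℂ) ^ n * (w ^ (k : ℕ) * q ^ ((k : ℕ) * (r : ℕ)))‖ ≤
      ‖w * q‖ ^ (k : ℕ) * ((r : ℝ) ^ n * ‖q‖ ^ ((r : ℕ) - 1)) := by
    intro k r
    obtain ⟨s, hs⟩ : ∃ s, (r : ℕ) = s + 1 := ⟨(r : ℕ) - 1, by have := r.pos; omega⟩
    have e1 : w ^ (k : ℕ) * q ^ ((k : ℕ) * (r : ℕ)) = (w * q) ^ (k : ℕ) * (q ^ s) ^ (k : ℕ) := by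
      rw [hs, mul_pow, ← pow_mul, mul_assoc, ← pow_add]
      ring_nf
    have e2 : ‖(q ^ s) ^ (k : ℕ)‖ ≤ ‖q‖ ^ s := by
      rw [norm_pow, norm_pow]
      exact pow_le_of_le_one (by positivity) (pow_le_one₀ (norm_nonneg _) hq.le) k.ne_zero
    have e3 : ‖(r : ℂ) ^ n‖ = (r : ℝ) ^ n := by simp
    have e4 : (r : ℕ) - 1 = s := by omega
    rw [e1, norm_mul, norm_mul, e3, norm_pow, e4]
    calc (r : ℝ) ^ n * (‖w * q‖ ^ (k : ℕ) * ‖(q ^ s) ^ (k : ℕ)‖)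
        ≤ (r : ℝ) ^ n * (‖w * q‖ ^ (k : ℕ) * ‖q‖ ^ s) := by gcongr
      _ = _ := by ring
  have s1 : Summable (fun k : ℕ+ => ‖w * q‖ ^ (k : ℕ)) :=
    (summable_geometric_of_lt_one (norm_nonneg _) hw).comp_injective PNat.coe_injective
  have s2 : Summable (fun r : ℕ+ => (r : ℝ) ^ n * ‖q‖ ^ ((r : ℕ) - 1)) := by
    have h := summable_pow_mul_geometric_of_norm_lt_one n (r := ‖q‖) (by simpa using hq)
    have h' : Summable (fun r : ℕ+ => ((r : ℕ) : ℝ) ^ n * ‖q‖ ^ ((r : ℕ) - 1)) := by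
      by_cases h0 : ‖q‖ = 0
      · refine summable_of_hasFiniteSupport ((Set.finite_singleton (1 : ℕ+)).subset ?_)
        intro r hr
        by_contra hne
        apply hr
        have : (r : ℕ) - 1 ≠ 0 := by
          have h1 : (r : ℕ) ≠ 1 := fun h => hne (by simpa using PNat.coe_eq_one_iff.mp h)
          have := r.pos
          omega
        simp [h0, this]
      · have h2 := (h.comp_injective PNat.coe_injective).mul_right (‖q‖⁻¹)
        refine h2.congr fun r => ?_
        have : ‖q‖ ^ (r : ℕ) = ‖q‖ ^ ((r : ℕ) - 1) * ‖q‖ := by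
          rw [← pow_succ, Nat.sub_add_cancel r.pos]
        simp only [Function.comp_apply]
        rw [this]
        field_simp
    exact h'
  have s3 : Summable (fun p : ℕ+ × ℕ+ =>
      (p.2 : ℂ) ^ n * (w ^ (p.1 : ℕ) * q ^ ((p.1 : ℕ) * (p.2 : ℕ)))) :=
    Summable.of_norm_bounded
      (s1.mul_of_nonneg s2 (fun _ => by positivity) (fun _ => by positivity))
      (fun p => key p.1 p.2)
  have inner : ∀ r : ℕ+, HasSum
      (fun k : ℕ+ => (r : ℂ) ^ n * (w ^ (k : ℕ) * q ^ ((k : ℕ) * (r : ℕ))))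
      ((r : ℂ) ^ n * (w * q ^ (r : ℕ) / (1 - w * q ^ (r : ℕ)))) := by
    intro r
    have hx : ‖w * q ^ (r : ℕ)‖ < 1 := by
      obtain ⟨s, hs⟩ : ∃ s, (r : ℕ) = s + 1 := ⟨(r : ℕ) - 1, by have := r.pos; omega⟩
      rw [hs, pow_succ', ← mul_assoc, norm_mul, norm_pow]
      calc ‖w * q‖ * ‖q‖ ^ s ≤ ‖w * q‖ * 1 := by
            gcongr
            exact pow_le_one₀ (norm_nonneg _) hq.le
        _ < 1 := by simpa using hw
    have h := (hasSum_geometric_of_norm_lt_one hx).mul_left (w * q ^ (r : ℕ))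
    have h2 : HasSum (fun k : ℕ+ => (w * q ^ (r : ℕ)) ^ (k : ℕ))
        (w * q ^ (r : ℕ) / (1 - w * q ^ (r : ℕ))) := by
      rw [← Equiv.pnatEquivNat.symm.hasSum_iff]
      refine (h.congr_fun ?_)
      intro k
      simp [pow_succ']
    refine (h2.mul_left ((r : ℂ) ^ n)).congr_fun ?_
    intro k
    rw [mul_pow, ← pow_mul, mul_comm (r : ℕ)]
  have s4 := s3.prod_symm
  have h := s4.hasSum.prod_fiberwise (fun r => inner r)
  refine ⟨s3, h.summable, ?_⟩
  rw [h.tsum_eq]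
  exact ((Equiv.prodComm ℕ+ ℕ+).tsum_eq _).symm

/-- On the strip `|Im z| < Im τ`, `J_n` is given by its defining double series, which converges
absolutely there. -/
theorem deformedEisenstein_eq_tsum (n : ℕ) (τ : ℍ) (z : ℂ) (hz : |z.im| < τ.im) :
    Summable (fun p : ℕ+ × ℕ+ => (p.2 : ℂ) ^ (n - 1) *
      (e z ^ (p.1 : ℕ) + (-1) ^ n * (e z)⁻¹ ^ (p.1 : ℕ)) * e τ ^ ((p.1 : ℕ) * (p.2 : ℕ))) ∧
    deformedEisenstein n τ z =
      (if n = 1 then e z / (e z - 1) else 0) + ((bernoulli n : ℚ) : ℂ)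
        - n * ∑' p : ℕ+ × ℕ+, (p.2 : ℂ) ^ (n - 1) *
          (e z ^ (p.1 : ℕ) + (-1) ^ n * (e z)⁻¹ ^ (p.1 : ℕ)) *
            e τ ^ ((p.1 : ℕ) * (p.2 : ℕ)) := by
  have hq := norm_e_lt_one τ
  obtain ⟨hz1, hz2⟩ := abs_lt.mp hz
  have hw1 : ‖e z * e τ‖ < 1 := by
    rw [norm_mul, norm_e, norm_e, ← Real.exp_add, Real.exp_lt_one_iff]
    have := mul_pos Real.two_pi_pos (by linarith : 0 < z.im + τ.im)
    simp only [UpperHalfPlane.coe_im]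
    linarith
  have hw2 : ‖(e z)⁻¹ * e τ‖ < 1 := by
    rw [norm_mul, norm_inv, norm_e, norm_e, ← Real.exp_neg, ← Real.exp_add, Real.exp_lt_one_iff]
    have := mul_pos Real.two_pi_pos (by linarith : 0 < -z.im + τ.im)
    simp only [UpperHalfPlane.coe_im]
    linarith
  obtain ⟨a1, a2, a3⟩ := hasSum_lambert (n - 1) _ _ hq hw1
  obtain ⟨b1, b2, b3⟩ := hasSum_lambert (n - 1) _ _ hq hw2
  have E : ∀ p : ℕ+ × ℕ+, (p.2 : ℂ) ^ (n - 1) *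
      (e z ^ (p.1 : ℕ) + (-1) ^ n * (e z)⁻¹ ^ (p.1 : ℕ)) * e τ ^ ((p.1 : ℕ) * (p.2 : ℕ)) =
      (p.2 : ℂ) ^ (n - 1) * (e z ^ (p.1 : ℕ) * e τ ^ ((p.1 : ℕ) * (p.2 : ℕ))) +
      (-1) ^ n * ((p.2 : ℂ) ^ (n - 1) *
        ((e z)⁻¹ ^ (p.1 : ℕ) * e τ ^ ((p.1 : ℕ) * (p.2 : ℕ)))) := fun p => by ring
  simp only [E]
  refine ⟨a1.add (b1.mul_left _), ?_⟩
  rw [a1.tsum_add (b1.mul_left _), tsum_mul_left, a3, b3, ← tsum_mul_left,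
    ← a2.tsum_add (b2.mul_left _), deformedEisenstein]
  congr 2
  refine tsum_congr fun r => ?_
  ring

/-- The Oberdieck derivative
`D_τ φ - (k/12) E₂ φ - J₁ D_z φ + m J₂ φ`, as a function of `z ∈ ℂ \ (ℤτ + ℤ)`. -/
def oberdieck (k : ℤ) (m : ℕ) (φ : ℍ → ℂ → ℂ) (τ : ℍ) (z : ℂ) : ℂ :=
  Dτ φ τ z - (k : ℂ) / 12 * EisensteinSeries.E2 τ * φ τ z
    - deformedEisenstein 1 τ z * Dz φ τ z + m * deformedEisenstein 2 τ z * φ τ z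

end

end JacobiForms

/-!
None of the summands of the Oberdieck derivative is covariant under the Jacobi group, but their error
terms compensate each other. Differentiating the invariance of `φ` under the Jacobi group gives the
transformation of `D_τ φ` and `D_z φ`; the error terms are cancelled by those of `E₂`, `J₁` and
`J₂`. Under the
translation `z ↦ z + lτ + u` the functions `J₁`, `J₂` change by `J₁ - l`, `J₂ - 2lJ₁ + l²`, which is
a telescoping argument in their Lambert series (`deformedEisenstein_add_lattice`). Under
`γ ∈ SL₂(ℤ)`, with `j = cτ + d`, they become `jJ₁ + cz` and `j²J₂ + 2czjJ₁ + c²z²`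
(`deformedEisenstein_one_smul`, `deformedEisenstein_two_smul`): the difference of the two sides is an
elliptic function without poles, hence constant, and the constant is found from the oddness of `J₁`
and from `J₂(τ, 0) = E₂(τ) / 6`.

The only pole to worry about is that of `J₁` at the lattice points. As `k` is even, `φ` is even in
`z`, so `D_z φ` vanishes at `z = 0` and `D_z φ / (ζ - 1)` is holomorphic; in terms of the Fourier
expansion `ζʳ - 1` is divided by `ζ - 1` term by term (`IsSummable.quotientSum_mul`). This extends
the Oberdieck derivative over `|Im z| < Im τ`, and its behaviour under translations extends it to
`ℍ × ℂ` (`exists_holomorphic_extension`). Uniqueness and the invariance of the extension at lattice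
points follow by continuity.

A holomorphic function on `ℍ × ℂ` of period one in both variables is the sum of its Fourier series
(`IsPeriodicHolomorphic.hasSum`). For the support of the coefficients, consider the lines
`z = xτ + y` with `x ∈ ℝ \ ℤ`. If `n - r² / (4m) ≥ δ` on the support of the expansion of `φ`, then
`φ`, `D_τ φ` and `D_z φ` are `O(exp (2π(mx² - δ) Im τ))` there, and `E₂`, `J₁`, `J₂` are bounded, so the
same estimate holds for the extension (`exists_bound_oberdieck`). Cauchy's estimate with `x` close to
`-r / (2m)` returns `n - r² / (4m) ≥ δ` for its coefficients
(`IsPeriodicHolomorphic.supportBound`). Jacobi forms are the case `δ = 0`, cusp forms the case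
`δ = 1 / (4m)`.
-/

namespace JacobiForms

/-! ### Series of holomorphic functions -/

/-- A series of holomorphic functions on an open subset of a complex normed space that is dominated
near a point by a summable sequence can be differentiated term by term there. The derivatives of the
terms are bounded by the Schwarz lemma. -/
theorem hasFDerivAt_tsum_of_bounded {ι E : Type*} [NormedAddCommGroup E] [NormedSpace ℂ E]
    {f : ι → E → ℂ} {p : E} {V : Set E} (hV : V ∈ nhds p) {u : ι → ℝ} (hu : Summable u)
    (hf : ∀ i, DifferentiableOn ℂ (f i) V) (hb : ∀ i, ∀ x ∈ V, ‖f i x‖ ≤ u i) :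
    Summable (fun i => fderiv ℂ (f i) p) ∧
      HasFDerivAt (fun x => ∑' i, f i x) (∑' i, fderiv ℂ (f i) p) p := by
  obtain ⟨R, hR, hRV⟩ := Metric.mem_nhds_iff.mp hV
  have hsub : ∀ x ∈ Metric.ball p (R / 2), Metric.ball x (R / 2) ⊆ V := fun x hx =>
    (Metric.ball_subset_ball' (by rw [Metric.mem_ball] at hx; linarith)).trans hRV
  have hbound : ∀ i, ∀ x ∈ Metric.ball p (R / 2), ‖fderiv ℂ (f i) x‖ ≤ 2 * u i / (R / 2) := by
    intro i x hx
    refine Complex.norm_fderiv_le_div_of_mapsTo_ball ((hf i).mono (hsub x hx)) ?_ (by positivity)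
    intro y hy
    rw [Metric.mem_closedBall, dist_eq_norm]
    have h1 := hb i y (hsub x hx hy)
    have h2 := hb i x (hsub x hx (Metric.mem_ball_self (by positivity)))
    linarith [norm_sub_le (f i y) (f i x)]
  have hp : p ∈ Metric.ball p (R / 2) := Metric.mem_ball_self (by positivity)
  have hu' : Summable fun i => 2 * u i / (R / 2) := (hu.mul_left 2).div_const _
  let _ : NormedSpace ℝ E := NormedSpace.restrictScalars ℝ ℂ E
  refine ⟨Summable.of_norm_bounded hu' fun i => hbound i p hp, ?_⟩
  refine hasFDerivAt_tsum_of_isPreconnected hu' Metric.isOpen_ball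
    (convex_ball p (R / 2)).isPreconnected (fun i x hx => ?_) hbound hp
    (Summable.of_norm_bounded hu fun i => hb i p (hRV (Metric.mem_ball_self hR))) hp
  exact ((hf i).differentiableAt (Filter.mem_of_superset (Metric.ball_mem_nhds x (by positivity))
    (hsub x hx))).hasFDerivAt

theorem differentiableOn_tsum_of_locally_bounded {ι E : Type*} [NormedAddCommGroup E]
    [NormedSpace ℂ E] {f : ι → E → ℂ} {U : Set E} (hU : IsOpen U)
    (hf : ∀ i, DifferentiableOn ℂ (f i) U)
    (hb : ∀ p ∈ U, ∃ V ∈ nhds p, ∃ u : ι → ℝ, Summable u ∧ ∀ i, ∀ x ∈ V, ‖f i x‖ ≤ u i) :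
    DifferentiableOn ℂ (fun x => ∑' i, f i x) U := by
  intro p hp
  obtain ⟨V, hV, u, hu, hb⟩ := hb p hp
  exact (hasFDerivAt_tsum_of_bounded (Filter.inter_mem hV (hU.mem_nhds hp)) hu
    (fun i => (hf i).mono Set.inter_subset_right)
    fun i x hx => hb i x hx.1).2.differentiableAt.differentiableWithinAt

/-! ### Fourier series in two variables -/

theorem e_add (a b : ℂ) : e (a + b) = e a * e b := by
  rw [e, e, e, ← Complex.exp_add, mul_add]

theorem e_zero : e 0 = 1 := by simp [e]

theorem e_ne_zero (w : ℂ) : e w ≠ 0 := Complex.exp_ne_zero _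

theorem e_neg (w : ℂ) : e (-w) = (e w)⁻¹ := by
  rw [e, e, ← Complex.exp_neg, mul_neg]

theorem e_zpow (w : ℂ) (n : ℤ) : e w ^ n = e (n * w) := by
  rw [e, e, ← Complex.exp_int_mul]
  ring_nf

theorem e_pow (w : ℂ) (n : ℕ) : e w ^ n = e (n * w) := by
  simpa using e_zpow w n

theorem e_eq_one_iff (w : ℂ) : e w = 1 ↔ ∃ n : ℤ, w = n := by
  rw [e, Complex.exp_eq_one_iff]
  refine exists_congr fun n => ?_
  rw [mul_comm _ w]
  exact mul_left_inj' Complex.two_pi_I_ne_zero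

theorem e_int (n : ℤ) : e n = 1 := (e_eq_one_iff n).mpr ⟨n, rfl⟩

theorem e_add_int (w : ℂ) (n : ℤ) : e (w + n) = e w := by rw [e_add, e_int, mul_one]

theorem hasDerivAt_e (w : ℂ) : HasDerivAt e (2 * Real.pi * Complex.I * e w) w := by
  have h : HasDerivAt e (e w * (2 * Real.pi * Complex.I * 1)) w :=
    ((hasDerivAt_id w).const_mul (2 * Real.pi * Complex.I)).cexp
  rwa [mul_one, mul_comm] at h

theorem differentiable_e : Differentiable ℂ e := fun w => (hasDerivAt_e w).differentiableAt

theorem continuous_e : Continuous e := differentiable_e.continuous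

/-- The domain `ℍ × ℂ` as an open subset of `ℂ × ℂ`. -/
def upperProd : Set (ℂ × ℂ) := {p | 0 < p.1.im}

theorem isOpen_upperProd : IsOpen upperProd :=
  isOpen_lt continuous_const (Complex.continuous_im.comp continuous_fst)

/-- The monomial `qⁿ ζʳ` as a function on `ℂ × ℂ`. -/
noncomputable def monomial (n r : ℤ) (p : ℂ × ℂ) : ℂ := e (n * p.1 + r * p.2)

theorem monomial_eq (n r : ℤ) (p : ℂ × ℂ) : monomial n r p = e p.1 ^ n * e p.2 ^ r := by
  rw [monomial, e_add, e_zpow, e_zpow]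

/-- The absolute value of `qⁿ ζʳ` at a point with imaginary parts `v` and `y`. -/
noncomputable def weight (n r : ℤ) (v y : ℝ) : ℝ := Real.exp (-(2 * Real.pi * (n * v + r * y)))

theorem weight_pos (n r : ℤ) (v y : ℝ) : 0 < weight n r v y := Real.exp_pos _

theorem norm_monomial (n r : ℤ) (p : ℂ × ℂ) :
    ‖monomial n r p‖ = weight n r p.1.im p.2.im := by
  rw [monomial, norm_e, weight]
  simp

theorem differentiable_monomial (n r : ℤ) : Differentiable ℂ (monomial n r) :=
  differentiable_e.comp (by fun_prop)

theorem fderiv_monomial_apply (n r : ℤ) (p v : ℂ × ℂ) :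
    fderiv ℂ (monomial n r) p v =
      2 * Real.pi * Complex.I * ((n * v.1 + r * v.2) * monomial n r p) := by
  have h1 : HasFDerivAt (fun p : ℂ × ℂ => (n : ℂ) * p.1 + r * p.2)
      ((n : ℂ) • ContinuousLinearMap.fst ℂ ℂ ℂ + (r : ℂ) • ContinuousLinearMap.snd ℂ ℂ ℂ) p :=
    (hasFDerivAt_fst.const_mul _).add (hasFDerivAt_snd.const_mul _)
  have h2 := (hasDerivAt_e (n * p.1 + r * p.2)).comp_hasFDerivAt p h1
  have h3 : fderiv ℂ (monomial n r) p = _ := h2.fderiv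
  rw [h3, monomial]
  simp
  ring

/-- The factor `|n|` is absorbed by moving the imaginary part of `τ` by `s` up or down, as
`|t| ≤ exp t + exp (-t)`. -/
theorem abs_mul_weight_le {s : ℝ} (hs : 0 < s) (n r : ℤ) (v y : ℝ) :
    |(n : ℝ)| * weight n r v y ≤
      (2 * Real.pi * s)⁻¹ * (weight n r (v - s) y + weight n r (v + s) y) := by
  have hpi := Real.two_pi_pos
  have key : |2 * Real.pi * s * n| ≤
      Real.exp (2 * Real.pi * s * n) + Real.exp (-(2 * Real.pi * s * n)) := by
    rw [abs_le]
    have h1 := Real.add_one_le_exp (2 * Real.pi * s * n)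
    have h2 := Real.add_one_le_exp (-(2 * Real.pi * s * n))
    have h3 := Real.exp_pos (2 * Real.pi * s * n)
    have h4 := Real.exp_pos (-(2 * Real.pi * s * n))
    constructor <;> linarith
  have e1 : weight n r (v - s) y = weight n r v y * Real.exp (2 * Real.pi * s * n) := by
    rw [weight, weight, ← Real.exp_add]
    ring_nf
  have e2 : weight n r (v + s) y = weight n r v y * Real.exp (-(2 * Real.pi * s * n)) := by
    rw [weight, weight, ← Real.exp_add]
    ring_nf
  rw [abs_mul, abs_of_pos (by positivity : 0 < 2 * Real.pi * s)] at key
  rw [e1, e2, ← mul_add, inv_mul_eq_div, le_div_iff₀ (by positivity)]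
  calc _ = weight n r v y * (2 * Real.pi * s * |(n : ℝ)|) := by ring
    _ ≤ _ := mul_le_mul_of_nonneg_left key (weight_pos n r v y).le

theorem weight_swap (n r : ℤ) (v y : ℝ) : weight n r v y = weight r n y v := by
  rw [weight, weight, add_comm]

/-- A function `|qⁿ ζʳ|` of the imaginary parts, being the exponential of a linear function, is
bounded on a rectangle by the sum of its values at the vertices. -/
theorem weight_le_vertices (n r : ℤ) {v v₁ v₂ y y₁ y₂ : ℝ} (h₁ : v₁ ≤ v) (h₂ : v ≤ v₂)
    (h₃ : y₁ ≤ y) (h₄ : y ≤ y₂) :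
    weight n r v y ≤ weight n r v₁ y₁ + weight n r v₁ y₂ + (weight n r v₂ y₁ + weight n r v₂ y₂) := by
  have key : ∀ (a : ℤ) {x x₁ x₂ : ℝ}, x₁ ≤ x → x ≤ x₂ →
      a * x₁ ≤ a * x ∨ a * x₂ ≤ a * x := by
    intro a x x₁ x₂ h h'
    rcases le_total 0 a with ha | ha
    · exact Or.inl (mul_le_mul_of_nonneg_left h (by exact_mod_cast ha))
    · exact Or.inr (mul_le_mul_of_nonpos_left h' (by exact_mod_cast ha))
  have mono : ∀ v' y' : ℝ, n * v' ≤ n * v → r * y' ≤ r * y → weight n r v y ≤ weight n r v' y' := by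
    intro v' y' h h'
    rw [weight, weight, Real.exp_le_exp, neg_le_neg_iff]
    exact mul_le_mul_of_nonneg_left (add_le_add h h') Real.two_pi_pos.le
  have p11 := weight_pos n r v₁ y₁
  have p12 := weight_pos n r v₁ y₂
  have p21 := weight_pos n r v₂ y₁
  have p22 := weight_pos n r v₂ y₂
  rcases key n h₁ h₂ with h | h <;> rcases key r h₃ h₄ with h' | h' <;>
    linarith [mono _ _ h h']

/-- The Fourier series with coefficients `c` converges absolutely on all of `ℍ × ℂ`. -/
def IsSummable (c : ℤ → ℤ → ℂ) : Prop :=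
  ∀ v y : ℝ, 0 < v → Summable fun i : ℤ × ℤ => ‖c i.1 i.2‖ * weight i.1 i.2 v y

theorem IsSummable.mul_left {c : ℤ → ℤ → ℂ} (hc : IsSummable c) :
    IsSummable fun n r => n * c n r := by
  intro v y hv
  refine Summable.of_nonneg_of_le (fun i => mul_nonneg (norm_nonneg _) (weight_pos _ _ _ _).le)
    (fun i => ?_) (((hc (v - v / 2) y (by linarith)).add (hc (v + v / 2) y (by linarith))).mul_left
      (2 * Real.pi * (v / 2))⁻¹)
  have h := mul_le_mul_of_nonneg_left (abs_mul_weight_le (half_pos hv) i.1 i.2 v y)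
    (norm_nonneg (c i.1 i.2))
  rw [norm_mul, Complex.norm_intCast]
  linarith

theorem IsSummable.mul_right {c : ℤ → ℤ → ℂ} (hc : IsSummable c) :
    IsSummable fun n r => r * c n r := by
  intro v y hv
  refine Summable.of_nonneg_of_le (fun i => mul_nonneg (norm_nonneg _) (weight_pos _ _ _ _).le)
    (fun i => ?_) (((hc v (y - 1) hv).add (hc v (y + 1) hv)).mul_left
      (2 * Real.pi * 1)⁻¹)
  have h := mul_le_mul_of_nonneg_left (abs_mul_weight_le one_pos i.2 i.1 y v)
    (norm_nonneg (c i.1 i.2))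
  simp only [weight_swap i.2 i.1] at h
  rw [norm_mul, Complex.norm_intCast]
  linarith

theorem exists_box {p : ℂ × ℂ} (hp : p ∈ upperProd) :
    {x : ℂ × ℂ | p.1.im / 2 ≤ x.1.im ∧ x.1.im ≤ 2 * p.1.im ∧ p.2.im - 1 ≤ x.2.im ∧
      x.2.im ≤ p.2.im + 1} ∈ nhds p := by
  have hp' : 0 < p.1.im := hp
  have c1 : Continuous fun x : ℂ × ℂ => x.1.im := Complex.continuous_im.comp continuous_fst
  have c2 : Continuous fun x : ℂ × ℂ => x.2.im := Complex.continuous_im.comp continuous_snd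
  filter_upwards [c1.continuousAt.eventually_const_le (by linarith : p.1.im / 2 < p.1.im),
    c1.continuousAt.eventually_le_const (by linarith : p.1.im < 2 * p.1.im),
    c2.continuousAt.eventually_const_le (by linarith : p.2.im - 1 < p.2.im),
    c2.continuousAt.eventually_le_const (by linarith : p.2.im < p.2.im + 1)] with x a b c d
  exact ⟨a, b, c, d⟩

theorem IsSummable.locally_bounded {c : ℤ → ℤ → ℂ} (hc : IsSummable c) {p : ℂ × ℂ}
    (hp : p ∈ upperProd) : ∃ V ∈ nhds p, ∃ u : ℤ × ℤ → ℝ, Summable u ∧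
      ∀ i, ∀ x ∈ V, ‖c i.1 i.2‖ * weight i.1 i.2 x.1.im x.2.im ≤ u i := by
  have hp' : 0 < p.1.im := hp
  refine ⟨_, exists_box hp, _, ((hc (p.1.im / 2) (p.2.im - 1) (by linarith)).add
    (hc (p.1.im / 2) (p.2.im + 1) (by linarith))).add
    ((hc (2 * p.1.im) (p.2.im - 1) (by linarith)).add
    (hc (2 * p.1.im) (p.2.im + 1) (by linarith))), ?_⟩
  rintro i x ⟨h1, h2, h3, h4⟩
  have := mul_le_mul_of_nonneg_left (weight_le_vertices i.1 i.2 h1 h2 h3 h4)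
    (norm_nonneg (c i.1 i.2))
  linarith

/-- The sum `∑ c(n, r) qⁿ ζʳ` as a function on `ℂ × ℂ`. -/
noncomputable def fourierSum (c : ℤ → ℤ → ℂ) (p : ℂ × ℂ) : ℂ :=
  ∑' i : ℤ × ℤ, c i.1 i.2 * monomial i.1 i.2 p

theorem IsSummable.summable {c : ℤ → ℤ → ℂ} (hc : IsSummable c) {p : ℂ × ℂ}
    (hp : p ∈ upperProd) : Summable fun i : ℤ × ℤ => c i.1 i.2 * monomial i.1 i.2 p :=
  Summable.of_norm_bounded (hc p.1.im p.2.im hp) fun i => by rw [norm_mul, norm_monomial]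

theorem IsSummable.fderiv_fourierSum {c : ℤ → ℤ → ℂ} (hc : IsSummable c) {p : ℂ × ℂ}
    (hp : p ∈ upperProd) : DifferentiableAt ℂ (fourierSum c) p ∧
      ∀ a b : ℂ, fderiv ℂ (fourierSum c) p (a, b) = 2 * Real.pi * Complex.I *
        (a * fourierSum (fun n r => n * c n r) p + b * fourierSum (fun n r => r * c n r) p) := by
  obtain ⟨V, hV, u, hu, hb⟩ := hc.locally_bounded hp
  obtain ⟨h1, h2⟩ := hasFDerivAt_tsum_of_bounded
    (f := fun (i : ℤ × ℤ) p => c i.1 i.2 * monomial i.1 i.2 p) hV hu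
    (fun i => ((differentiable_monomial i.1 i.2).const_mul _).differentiableOn)
    (fun i x hx => by rw [norm_mul, norm_monomial]; exact hb i x hx)
  refine ⟨h2.differentiableAt, fun a b => ?_⟩
  have h3 : fderiv ℂ (fourierSum c) p = _ := h2.fderiv
  have h4 : ∀ i : ℤ × ℤ, (fderiv ℂ (fun p => c i.1 i.2 * monomial i.1 i.2 p) p) (a, b) =
      2 * Real.pi * Complex.I * (a * (i.1 * c i.1 i.2 * monomial i.1 i.2 p) +
        b * (i.2 * c i.1 i.2 * monomial i.1 i.2 p)) := by
    intro i
    rw [fderiv_const_mul (differentiable_monomial i.1 i.2 p)]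
    simp only [smul_apply, fderiv_monomial_apply, smul_eq_mul]
    ring
  rw [h3]
  have h5 := (ContinuousLinearMap.apply ℂ ℂ ((a, b) : ℂ × ℂ)).map_tsum h1
  simp only [ContinuousLinearMap.apply_apply] at h5
  rw [h5]
  simp only [h4]
  rw [tsum_mul_left, Summable.tsum_add ((hc.mul_left.summable hp).mul_left a)
    ((hc.mul_right.summable hp).mul_left b), tsum_mul_left, tsum_mul_left]
  rfl

/-- A function on `ℍ × ℂ`, extended to `ℂ × ℂ`. -/
noncomputable def extend (φ : ℍ → ℂ → ℂ) (p : ℂ × ℂ) : ℂ := φ (UpperHalfPlane.ofComplex p.1) p.2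

theorem extend_coe (φ : ℍ → ℂ → ℂ) (τ : ℍ) (z : ℂ) : extend φ (τ, z) = φ τ z := by
  rw [extend, UpperHalfPlane.ofComplex_apply]

theorem coe_mem_upperProd (τ : ℍ) (z : ℂ) : ((τ : ℂ), z) ∈ upperProd := τ.im_pos

theorem HasFourierExpansion.isSummable {φ : ℍ → ℂ → ℂ} {c : ℤ → ℤ → ℂ}
    (h : HasFourierExpansion φ c) : IsSummable c := by
  intro v y hv
  have := (h ⟨⟨0, v⟩, hv⟩ ⟨0, y⟩).summable.norm
  refine this.congr fun i => ?_
  rw [mul_assoc, ← monomial_eq i.1 i.2 (_, _), norm_mul, norm_monomial]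

theorem HasFourierExpansion.eq_fourierSum {φ : ℍ → ℂ → ℂ} {c : ℤ → ℤ → ℂ}
    (h : HasFourierExpansion φ c) (τ : ℍ) (z : ℂ) : φ τ z = fourierSum c (τ, z) := by
  rw [← (h τ z).tsum_eq, fourierSum]
  refine tsum_congr fun i => ?_
  rw [mul_assoc, ← monomial_eq i.1 i.2 ((τ : ℂ), z)]

theorem HasFourierExpansion.extend_eqOn {φ : ℍ → ℂ → ℂ} {c : ℤ → ℤ → ℂ}
    (h : HasFourierExpansion φ c) : Set.EqOn (extend φ) (fourierSum c) upperProd := by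
  intro p hp
  have := h.eq_fourierSum ⟨p.1, hp⟩ p.2
  exact (extend_coe φ ⟨p.1, hp⟩ p.2).trans this

/-- The total derivative of `φ` in terms of `D_τ φ` and `D_z φ`. -/
theorem fderiv_extend {φ : ℍ → ℂ → ℂ} (h : IsHolomorphic φ) (τ : ℍ) (z : ℂ) :
    DifferentiableAt ℂ (extend φ) (τ, z) ∧ ∀ a b : ℂ, fderiv ℂ (extend φ) (τ, z) (a, b) =
      2 * Real.pi * Complex.I * (a * Dτ φ τ z + b * Dz φ τ z) := by
  have hd : DifferentiableAt ℂ (extend φ) (τ, z) :=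
    h.differentiableAt (isOpen_upperProd.mem_nhds (coe_mem_upperProd τ z))
  refine ⟨hd, fun a b => ?_⟩
  have h1 : HasDerivAt (fun w : ℂ => φ (UpperHalfPlane.ofComplex w) z)
      (fderiv ℂ (extend φ) (τ, z) (1, 0)) τ :=
    hd.hasFDerivAt.comp_hasDerivAt (f := fun w : ℂ => (w, z)) (τ : ℂ)
      ((hasDerivAt_id _).prodMk (hasDerivAt_const _ _))
  have h2 : HasDerivAt (fun w : ℂ => φ τ w) (fderiv ℂ (extend φ) (τ, z) (0, 1)) z := by
    have := hd.hasFDerivAt.comp_hasDerivAt (f := fun w : ℂ => ((τ : ℂ), w)) z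
      ((hasDerivAt_const _ _).prodMk (hasDerivAt_id _))
    refine this.congr_of_eventuallyEq (Filter.Eventually.of_forall fun w => ?_)
    exact (extend_coe φ τ w).symm
  have h3 : ((a, b) : ℂ × ℂ) = a • ((1, 0) : ℂ × ℂ) + b • ((0, 1) : ℂ × ℂ) := by simp
  rw [Dτ, Dz, h1.deriv, h2.deriv, h3, map_add, map_smul, map_smul]
  have := Complex.two_pi_I_ne_zero
  field_simp
  simp only [smul_eq_mul]

theorem HasFourierExpansion.derivatives {φ : ℍ → ℂ → ℂ} {c : ℤ → ℤ → ℂ} (hφ : IsHolomorphic φ)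
    (h : HasFourierExpansion φ c) (τ : ℍ) (z : ℂ) :
    Dτ φ τ z = fourierSum (fun n r => n * c n r) (τ, z) ∧
      Dz φ τ z = fourierSum (fun n r => r * c n r) (τ, z) := by
  have h1 := (fderiv_extend hφ τ z).2
  have h2 := (h.isSummable.fderiv_fourierSum (coe_mem_upperProd τ z)).2
  have h3 : fderiv ℂ (extend φ) (τ, z) = fderiv ℂ (fourierSum c) (τ, z) :=
    (h.extend_eqOn.eventuallyEq_of_mem
      (isOpen_upperProd.mem_nhds (coe_mem_upperProd τ z))).fderiv_eq
  have h4 : ∀ a b, _ = _ := fun a b => (h1 a b).symm.trans ((congrArg (· (a, b)) h3).trans (h2 a b))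
  have := Complex.two_pi_I_ne_zero
  constructor
  · simpa [this] using h4 1 0
  · simpa [this] using h4 0 1

/-! ### Fourier expansion of periodic holomorphic functions -/

/-- By Cauchy's theorem for a rectangle, the integral of a periodic holomorphic function over a
horizontal period does not depend on the height. -/
theorem integral_period_eq {g : ℂ → ℂ} {s : Set ℝ} (hs : s.OrdConnected)
    (hg : DifferentiableOn ℂ g {z | z.im ∈ s}) (hper : ∀ z : ℂ, z.im ∈ s → g (z + 1) = g z)
    {v₁ v₂ : ℝ} (h₁ : v₁ ∈ s) (h₂ : v₂ ∈ s) :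
    ∫ x : ℝ in (0 : ℝ)..1, g (x + v₁ * Complex.I) = ∫ x : ℝ in (0 : ℝ)..1, g (x + v₂ * Complex.I) := by
  have h := Complex.integral_boundary_rect_eq_zero_of_differentiableOn g ⟨0, v₁⟩ ⟨1, v₂⟩
    (hg.mono fun z hz => hs.uIcc_subset h₁ h₂ hz.2)
  have hside : ∫ y : ℝ in v₁..v₂, g ((1 : ℝ) + y * Complex.I) =
      ∫ y : ℝ in v₁..v₂, g ((0 : ℝ) + y * Complex.I) := by
    refine intervalIntegral.integral_congr fun y hy => ?_
    have := hper ((0 : ℝ) + y * Complex.I) (by simpa using hs.uIcc_subset h₁ h₂ hy)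
    simp only [← this]
    congr 1
    push_cast
    ring
  simp only [hside, add_sub_assoc, sub_self, add_zero] at h
  exact sub_eq_zero.mp h

theorem hasSum_fourier {f : ℝ → ℂ} (hf : Continuous f) (hper : Function.Periodic f 1)
    (hs : Summable fun n : ℤ => ∫ x : ℝ in (0 : ℝ)..1, f x * e (-n * x)) (x : ℝ) :
    HasSum (fun n : ℤ => (∫ x : ℝ in (0 : ℝ)..1, f x * e (-n * x)) * e (n * x)) (f x) := by
  let F : C(AddCircle (1 : ℝ), ℂ) := ⟨hper.lift, hf.quotient_lift _⟩
  have hF : ∀ x : ℝ, F x = f x := fun x => hper.lift_coe x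
  have he : ∀ (n : ℤ) (x : ℝ), fourier n (x : AddCircle (1 : ℝ)) = e (n * x) := by
    intro n x
    rw [fourier_coe_apply, e]
    congr 1
    push_cast
    ring
  have hc : ∀ n : ℤ, fourierCoeff F n = ∫ x : ℝ in (0 : ℝ)..1, f x * e (-n * x) := by
    intro n
    rw [fourierCoeff_eq_intervalIntegral F n 0]
    simp only [hF, he, smul_eq_mul, zero_add, div_one, one_smul, mul_comm]
    push_cast
    rfl
  have hc' : fourierCoeff F = fun n : ℤ => ∫ x : ℝ in (0 : ℝ)..1, f x * e (-n * x) := funext hc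
  have h := has_pointwise_sum_fourier_series_of_summable (f := F) (by rwa [hc']) x
  simpa only [hc, he, hF, smul_eq_mul] using h

/-- `F` is holomorphic on `ℍ × ℂ` and invariant under `(τ, z) ↦ (τ + 1, z)` and
`(τ, z) ↦ (τ, z + 1)`. -/
structure IsPeriodicHolomorphic (F : ℂ × ℂ → ℂ) : Prop where
  differentiableOn : DifferentiableOn ℂ F upperProd
  add_one_left : ∀ p ∈ upperProd, F (p.1 + 1, p.2) = F p
  add_one_right : ∀ p ∈ upperProd, F (p.1, p.2 + 1) = F p

theorem isPeriodicHolomorphic_monomial (n r : ℤ) : IsPeriodicHolomorphic (monomial n r) where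
  differentiableOn := (differentiable_monomial n r).differentiableOn
  add_one_left p _ := by
    rw [monomial, monomial, mul_add, mul_one, add_right_comm, e_add_int]
  add_one_right p _ := by
    rw [monomial, monomial, mul_add, mul_one, ← add_assoc, e_add_int]

theorem IsPeriodicHolomorphic.mul {F G : ℂ × ℂ → ℂ} (hF : IsPeriodicHolomorphic F)
    (hG : IsPeriodicHolomorphic G) : IsPeriodicHolomorphic (fun p => F p * G p) where
  differentiableOn := hF.differentiableOn.mul hG.differentiableOn
  add_one_left p hp := by rw [hF.add_one_left p hp, hG.add_one_left p hp]
  add_one_right p hp := by rw [hF.add_one_right p hp, hG.add_one_right p hp]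

/-- The mean of `F` over the torus at heights `v` and `y`. -/
noncomputable def torusMean (F : ℂ × ℂ → ℂ) (v y : ℝ) : ℂ :=
  ∫ x : ℝ in (0 : ℝ)..1, ∫ u : ℝ in (0 : ℝ)..1, F (x + v * Complex.I, u + y * Complex.I)

theorem IsPeriodicHolomorphic.continuous {F : ℂ × ℂ → ℂ} (hF : IsPeriodicHolomorphic F) {v : ℝ}
    (hv : 0 < v) (y : ℝ) :
    Continuous fun a : ℝ × ℝ => F (a.1 + v * Complex.I, a.2 + y * Complex.I) := by
  refine hF.differentiableOn.continuousOn.comp_continuous (by fun_prop) fun a => ?_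
  change 0 < ((a.1 : ℂ) + v * Complex.I).im
  simpa using hv

theorem IsPeriodicHolomorphic.integral_right_eq {F : ℂ × ℂ → ℂ} (hF : IsPeriodicHolomorphic F)
    {w : ℂ} (hw : 0 < w.im) (y y' : ℝ) :
    ∫ u : ℝ in (0 : ℝ)..1, F (w, u + y * Complex.I) =
      ∫ u : ℝ in (0 : ℝ)..1, F (w, u + y' * Complex.I) := by
  refine integral_period_eq (g := fun z => F (w, z)) (s := Set.univ) Set.ordConnected_univ ?_
    (fun z _ => hF.add_one_right (w, z) hw) (Set.mem_univ _) (Set.mem_univ _)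
  exact hF.differentiableOn.comp (by fun_prop) fun z _ => hw

theorem IsPeriodicHolomorphic.torusMean_eq {F : ℂ × ℂ → ℂ} (hF : IsPeriodicHolomorphic F)
    {v v' : ℝ} (hv : 0 < v) (hv' : 0 < v') (y y' : ℝ) : torusMean F v y = torusMean F v' y' := by
  have step1 : torusMean F v y = torusMean F v y' := by
    refine intervalIntegral.integral_congr fun x _ => ?_
    exact hF.integral_right_eq (by simpa using hv) y y'
  have swap : ∀ {v : ℝ}, 0 < v → torusMean F v y' =
      ∫ u : ℝ in (0 : ℝ)..1, ∫ x : ℝ in (0 : ℝ)..1, F (x + v * Complex.I, u + y' * Complex.I) := by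
    intro v hv
    refine MeasureTheory.intervalIntegral_intervalIntegral_swap (MeasureTheory.IntegrableOn.mono_set
      ((hF.continuous hv y').continuousOn.integrableOn_compact
        ((isCompact_uIcc (a := 0) (b := 1)).prod (isCompact_uIcc (a := 0) (b := 1))))
      (Set.prod_mono Set.uIoc_subset_uIcc Set.uIoc_subset_uIcc))
  rw [step1, swap hv, swap hv']
  refine intervalIntegral.integral_congr fun u _ => ?_
  refine integral_period_eq (g := fun w => F (w, u + y' * Complex.I)) (s := Set.Ioi 0)
    Set.ordConnected_Ioi ?_ (fun w hw => hF.add_one_left (w, _) hw) hv hv'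
  exact hF.differentiableOn.comp (by fun_prop) fun z hz => hz

theorem norm_torusMean_le {F : ℂ × ℂ → ℂ} {v y C : ℝ}
    (hC : ∀ x u : ℝ, ‖F (x + v * Complex.I, u + y * Complex.I)‖ ≤ C) : ‖torusMean F v y‖ ≤ C := by
  have h : ∀ x : ℝ, ‖∫ u : ℝ in (0 : ℝ)..1, F (x + v * Complex.I, u + y * Complex.I)‖ ≤ C := by
    intro x
    simpa using intervalIntegral.norm_integral_le_of_norm_le_const (a := (0 : ℝ)) (b := 1)
      fun u _ => hC x u
  rw [torusMean]
  simpa using intervalIntegral.norm_integral_le_of_norm_le_const (a := (0 : ℝ)) (b := 1)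
    fun x _ => h x

/-- The Fourier coefficients of `F`, computed at heights `1` and `0`. -/
noncomputable def coeffs (F : ℂ × ℂ → ℂ) (n r : ℤ) : ℂ :=
  torusMean (fun p => F p * monomial (-n) (-r) p) 1 0

theorem IsPeriodicHolomorphic.coeffs_eq {F : ℂ × ℂ → ℂ} (hF : IsPeriodicHolomorphic F)
    (n r : ℤ) {v : ℝ} (hv : 0 < v) (y : ℝ) :
    coeffs F n r = torusMean (fun p => F p * monomial (-n) (-r) p) v y :=
  (hF.mul (isPeriodicHolomorphic_monomial _ _)).torusMean_eq one_pos hv _ _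

/-- Cauchy's estimate for the Fourier coefficients. -/
theorem IsPeriodicHolomorphic.norm_coeffs_le {F : ℂ × ℂ → ℂ} (hF : IsPeriodicHolomorphic F)
    (n r : ℤ) {v : ℝ} (hv : 0 < v) (y : ℝ) {C : ℝ}
    (hC : ∀ x u : ℝ, ‖F (x + v * Complex.I, u + y * Complex.I)‖ ≤ C) :
    ‖coeffs F n r‖ ≤ C * Real.exp (2 * Real.pi * (n * v + r * y)) := by
  rw [hF.coeffs_eq n r hv y]
  refine norm_torusMean_le fun x u => ?_
  rw [norm_mul, norm_monomial, weight]
  refine mul_le_mul (hC x u) (le_of_eq ?_) (Real.exp_pos _).le ((norm_nonneg _).trans (hC 0 0))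
  congr 1
  simp
  ring

theorem IsPeriodicHolomorphic.exists_bound {F : ℂ × ℂ → ℂ} (hF : IsPeriodicHolomorphic F)
    {v : ℝ} (hv : 0 < v) (y : ℝ) : ∃ C : ℝ, ∀ v' ∈ Set.Icc (v / 2) (2 * v),
      ∀ y' ∈ Set.Icc (y - 1) (y + 1), ∀ x u : ℝ,
        ‖F (x + v' * Complex.I, u + y' * Complex.I)‖ ≤ C := by
  let K : Set ((ℝ × ℝ) × (ℝ × ℝ)) :=
    (Set.Icc 0 1 ×ˢ Set.Icc 0 1) ×ˢ (Set.Icc (v / 2) (2 * v) ×ˢ Set.Icc (y - 1) (y + 1))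
  have hK : IsCompact K := (isCompact_Icc.prod isCompact_Icc).prod (isCompact_Icc.prod isCompact_Icc)
  have hcont : ContinuousOn
      (fun a : (ℝ × ℝ) × (ℝ × ℝ) => F (a.1.1 + a.2.1 * Complex.I, a.1.2 + a.2.2 * Complex.I)) K := by
    refine hF.differentiableOn.continuousOn.comp (by fun_prop) fun a ha => ?_
    change 0 < ((a.1.1 : ℂ) + a.2.1 * Complex.I).im
    simpa using lt_of_lt_of_le (half_pos hv) ha.2.1.1
  obtain ⟨C, hC⟩ := hK.exists_bound_of_continuousOn hcont
  refine ⟨C, fun v' hv' y' hy' x u => ?_⟩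
  have hpos : 0 < v' := (half_pos hv).trans_le hv'.1
  have p1 : ∀ u : ℝ, Function.Periodic (fun x : ℝ => F (x + v' * Complex.I, u + y' * Complex.I))
      1 := by
    intro u x
    have := hF.add_one_left (x + v' * Complex.I, u + y' * Complex.I)
      (show 0 < ((x : ℂ) + v' * Complex.I).im by simpa using hpos)
    simp only [← this]
    congr 2
    push_cast
    ring
  have p2 : ∀ x : ℝ, Function.Periodic (fun u : ℝ => F (x + v' * Complex.I, u + y' * Complex.I))
      1 := by
    intro x u
    have := hF.add_one_right (x + v' * Complex.I, u + y' * Complex.I)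
      (show 0 < ((x : ℂ) + v' * Complex.I).im by simpa using hpos)
    simp only [← this]
    congr 2
    push_cast
    ring
  obtain ⟨x₀, hx₀, hx⟩ := (p1 u).exists_mem_Ico₀ one_pos x
  obtain ⟨u₀, hu₀, hu⟩ := (p2 x₀).exists_mem_Ico₀ one_pos u
  rw [hx, hu]
  exact hC ((x₀, u₀), (v', y')) ⟨⟨Set.Ico_subset_Icc_self hx₀, Set.Ico_subset_Icc_self hu₀⟩,
    hv', hy'⟩

/-- Cauchy's estimate at heights on the far side of those of the point makes the series geometric in
`|n|` and `|r|`. -/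
theorem IsPeriodicHolomorphic.isSummable_coeffs {F : ℂ × ℂ → ℂ} (hF : IsPeriodicHolomorphic F) :
    IsSummable (coeffs F) := by
  intro v y hv
  obtain ⟨C, hC⟩ := hF.exists_bound hv y
  have hgeom : ∀ s : ℝ, 0 < s → Summable fun n : ℤ => Real.exp (-(2 * Real.pi * (s * |(n : ℝ)|))) := by
    intro s hs
    have hnat : Summable fun n : ℕ => Real.exp (-(2 * Real.pi * (s * |((n : ℤ) : ℝ)|))) := by
      have h := summable_geometric_of_lt_one (Real.exp_pos (-(2 * Real.pi * s))).le
        (Real.exp_lt_one_iff.mpr (by have := Real.pi_pos; simp only [neg_lt_zero]; positivity))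
      refine h.congr fun n => ?_
      rw [← Real.exp_nat_mul, Int.cast_natCast, Nat.abs_cast]
      ring_nf
    refine Summable.of_nat_of_neg hnat (hnat.congr fun n => ?_)
    rw [Int.cast_neg, abs_neg]
  refine Summable.of_nonneg_of_le (fun i => mul_nonneg (norm_nonneg _) (weight_pos _ _ _ _).le)
    (fun i => ?_) (((hgeom (v / 2) (half_pos hv)).mul_of_nonneg (hgeom 1 one_pos)
      (fun _ => (Real.exp_pos _).le) (fun _ => (Real.exp_pos _).le)).mul_left C)
  obtain ⟨v', hv', h1⟩ : ∃ v' ∈ Set.Icc (v / 2) (2 * v),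
      (i.1 : ℝ) * v' - i.1 * v = -(v / 2 * |(i.1 : ℝ)|) := by
    rcases le_total 0 (i.1 : ℝ) with h | h
    · exact ⟨v - v / 2, ⟨by linarith, by linarith⟩, by rw [abs_of_nonneg h]; ring⟩
    · exact ⟨v + v / 2, ⟨by linarith, by linarith⟩, by rw [abs_of_nonpos h]; ring⟩
  obtain ⟨y', hy', h2⟩ : ∃ y' ∈ Set.Icc (y - 1) (y + 1),
      (i.2 : ℝ) * y' - i.2 * y = -(1 * |(i.2 : ℝ)|) := by
    rcases le_total 0 (i.2 : ℝ) with h | h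
    · exact ⟨y - 1, ⟨by linarith, by linarith⟩, by rw [abs_of_nonneg h]; ring⟩
    · exact ⟨y + 1, ⟨by linarith, by linarith⟩, by rw [abs_of_nonpos h]; ring⟩
  have h3 := hF.norm_coeffs_le i.1 i.2 ((half_pos hv).trans_le hv'.1) y' (hC v' hv' y' hy')
  refine (mul_le_mul_of_nonneg_right h3 (weight_pos _ _ _ _).le).trans (le_of_eq ?_)
  rw [weight, mul_assoc, ← Real.exp_add, ← Real.exp_add]
  congr 2
  linear_combination (2 * Real.pi) * (h1 + h2)

/-- A holomorphic function on `ℍ × ℂ` of period one in both variables is the sum of its absolutely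
convergent Fourier series. -/
theorem IsPeriodicHolomorphic.hasSum {F : ℂ × ℂ → ℂ} (hF : IsPeriodicHolomorphic F) {p : ℂ × ℂ}
    (hp : p ∈ upperProd) : HasSum (fun i : ℤ × ℤ => coeffs F i.1 i.2 * monomial i.1 i.2 p) (F p) := by
  obtain ⟨w, z⟩ := p
  set v := w.im with hv'
  set y := z.im with hy'
  have hv : 0 < v := hp
  have hw : w = (w.re : ℂ) + v * Complex.I := (Complex.re_add_im w).symm
  have hz : z = (z.re : ℂ) + y * Complex.I := (Complex.re_add_im z).symm
  have hsum := hF.isSummable_coeffs.summable hp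
  -- the Fourier coefficients in the second variable alone
  let h : ℤ → ℂ → ℂ := fun r a =>
    ∫ u : ℝ in (0 : ℝ)..1, F (a, u + y * Complex.I) * monomial 0 (-r) (a, u + y * Complex.I)
  have split : ∀ (n r : ℤ) (a b : ℂ),
      monomial (-n) (-r) (a, b) = monomial 0 (-r) (a, b) * e (-n * a) := by
    intro n r a b
    rw [monomial, monomial, ← e_add]
    push_cast
    ring_nf
  have hFr : ∀ r : ℤ, IsPeriodicHolomorphic fun p => F p * monomial 0 (-r) p := fun r =>
    hF.mul (isPeriodicHolomorphic_monomial _ _)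
  have hcoeff : ∀ n r : ℤ, coeffs F n r * e (n * (v * Complex.I)) =
      ∫ x : ℝ in (0 : ℝ)..1, h r (x + v * Complex.I) * e (-n * x) := by
    intro n r
    rw [hF.coeffs_eq n r hv y, torusMean, ← intervalIntegral.integral_mul_const]
    refine intervalIntegral.integral_congr fun x _ => ?_
    simp only [split, ← mul_assoc, intervalIntegral.integral_mul_const]
    rw [mul_assoc, ← e_add]
    congr 2
    ring
  have stepA : ∀ r : ℤ, HasSum (fun n : ℤ => coeffs F n r * monomial n r (w, z))
      (h r w * e (r * z)) := by
    intro r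
    have hf : Continuous fun x : ℝ => h r (x + v * Complex.I) :=
      intervalIntegral.continuous_parametric_intervalIntegral_of_continuous'
        ((hFr r).continuous hv y) 0 1
    have hper : Function.Periodic (fun x : ℝ => h r (x + v * Complex.I)) 1 := by
      intro x
      refine intervalIntegral.integral_congr fun u _ => ?_
      have := (hFr r).add_one_left (x + v * Complex.I, u + y * Complex.I)
        (show 0 < ((x : ℂ) + v * Complex.I).im by simpa using hv)
      simp only [← this]
      congr 3 <;> (push_cast; ring)
    have hs : Summable fun n : ℤ => coeffs F n r * e (n * (v * Complex.I)) := by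
      have h1 := ((hsum.prod_symm).prod_factor r).mul_right (e (-(r * z)))
      refine Summable.of_norm (h1.norm.congr fun n => ?_)
      simp only [monomial, Prod.swap_prod_mk, norm_mul, mul_assoc, norm_e]
      rw [← Real.exp_add]
      congr 2
      simp [← hv']
      ring
    have h2 := hasSum_fourier hf hper (by simpa only [hcoeff] using hs) w.re
    simp only [← hcoeff, ← hw] at h2
    refine (h2.mul_right (e (r * z))).congr_fun fun n => ?_
    rw [monomial, e_add]
    conv_lhs => rw [hw, mul_add, e_add]
    ring
  have h3 : HasSum (fun r : ℤ => h r w * e (r * z)) _ := hsum.prod_symm.hasSum.prod_fiberwise stepA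
  have hcoeff' : ∀ r : ℤ, h r w * e (r * (y * Complex.I)) =
      ∫ u : ℝ in (0 : ℝ)..1, F (w, u + y * Complex.I) * e (-r * u) := by
    intro r
    rw [← intervalIntegral.integral_mul_const]
    refine intervalIntegral.integral_congr fun u _ => ?_
    simp only [monomial, mul_assoc]
    rw [← e_add]
    congr 2
    push_cast
    ring
  have stepB : HasSum (fun r : ℤ => h r w * e (r * z)) (F (w, z)) := by
    have hf : Continuous fun u : ℝ => F (w, u + y * Complex.I) :=
      hF.differentiableOn.continuousOn.comp_continuous (by fun_prop) fun u => hp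
    have hper : Function.Periodic (fun u : ℝ => F (w, u + y * Complex.I)) 1 := by
      intro u
      have := hF.add_one_right (w, u + y * Complex.I) hp
      simp only [← this]
      congr 2
      push_cast
      ring
    have hs : Summable fun r : ℤ => h r w * e (r * (y * Complex.I)) := by
      refine Summable.of_norm (h3.summable.norm.congr fun r => ?_)
      simp [norm_e, ← hy']
    have h4 := hasSum_fourier hf hper (by simpa only [hcoeff'] using hs) z.re
    simp only [← hcoeff', ← hz] at h4
    refine h4.congr_fun fun r => ?_
    conv_lhs => rw [hz, mul_add, e_add]
    ring
  have h5 := h3.unique stepB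
  have h6 := hsum.prod_symm.hasSum
  rw [h5] at h6
  exact (Equiv.prodComm ℤ ℤ).hasSum_iff.mp h6

/-! ### Lambert series and the deformed Eisenstein series -/

/-- The sum `ζ / (1 - ζ)` of the geometric series `ζ + ζ² + ⋯`, where `ζ = e w`. -/
noncomputable def geomTerm (w : ℂ) : ℂ := e w / (1 - e w)

/-- The bound `1 / |exp (2πt) - 1|` for `|geomTerm w|` in terms of `t = Im w`. -/
noncomputable def geomBound (t : ℝ) : ℝ := 1 / |Real.exp (2 * Real.pi * t) - 1|

theorem geomBound_nonneg (t : ℝ) : 0 ≤ geomBound t := by unfold geomBound; positivity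

theorem norm_geomTerm_le {w : ℂ} (hw : w.im ≠ 0) : ‖geomTerm w‖ ≤ geomBound w.im := by
  have h1 : geomTerm w = 1 / (e (-w) - 1) := by
    rw [geomTerm, e_neg]
    have := e_ne_zero w
    have h2 : (e w)⁻¹ - 1 = (1 - e w) / e w := by field_simp
    rw [h2, one_div_div]
  rw [h1, norm_div, norm_one, geomBound]
  refine one_div_le_one_div_of_le (abs_pos.mpr fun h => ?_) ?_
  · rw [sub_eq_zero, Real.exp_eq_one_iff] at h
    have := Real.pi_pos
    simp [this.ne', hw] at h
  · have := abs_norm_sub_norm_le (e (-w)) 1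
    rwa [norm_e, norm_one, Complex.neg_im, mul_neg, neg_neg] at this

theorem differentiableAt_geomTerm {w : ℂ} (hw : e w ≠ 1) : DifferentiableAt ℂ geomTerm w :=
  (differentiable_e w).fun_div ((differentiable_e w).const_sub 1) (sub_ne_zero.mpr hw.symm)

theorem geomBound_anti {s t : ℝ} (hs : 0 < s) (h : s ≤ t) : geomBound t ≤ geomBound s := by
  have hpi := Real.two_pi_pos
  have h0 : 1 < Real.exp (2 * Real.pi * s) := Real.one_lt_exp_iff.mpr (by positivity)
  have h1 : Real.exp (2 * Real.pi * s) ≤ Real.exp (2 * Real.pi * t) :=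
    Real.exp_le_exp.mpr (mul_le_mul_of_nonneg_left h hpi.le)
  rw [geomBound, geomBound, abs_of_pos (by linarith), abs_of_pos (by linarith)]
  exact one_div_le_one_div_of_le (by linarith) (by linarith)

/-- For fixed slope `t`, the bound is largest at height one, on either side of zero. -/
theorem geomBound_mul_le {t v : ℝ} (ht : t ≠ 0) (hv : 1 ≤ v) : geomBound (t * v) ≤ geomBound t := by
  have hpi := Real.two_pi_pos
  rcases lt_or_gt_of_ne ht with h | h
  · have h0 : Real.exp (2 * Real.pi * t) < 1 :=
      Real.exp_lt_one_iff.mpr (mul_neg_of_pos_of_neg hpi h)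
    have h1 : Real.exp (2 * Real.pi * (t * v)) ≤ Real.exp (2 * Real.pi * t) :=
      Real.exp_le_exp.mpr (mul_le_mul_of_nonneg_left (by nlinarith) hpi.le)
    rw [geomBound, geomBound, abs_of_neg (by linarith), abs_of_neg (by linarith)]
    exact one_div_le_one_div_of_le (by linarith) (by linarith)
  · exact geomBound_anti h (by nlinarith)

theorem summable_geomBound (k : ℕ) (x : ℝ) {s : ℝ} (hs : 0 < s) :
    Summable fun r : ℕ+ => (r : ℝ) ^ k * geomBound (x + r * s) := by
  have hpi := Real.two_pi_pos
  set ρ := Real.exp (-(2 * Real.pi * s)) with hρ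
  have hρ1 : ‖ρ‖ < 1 := by
    rw [Real.norm_eq_abs, abs_of_pos (Real.exp_pos _), Real.exp_lt_one_iff]
    have := mul_pos hpi hs
    linarith
  have hsum : Summable fun n : ℕ => (n : ℝ) ^ k * geomBound (x + n * s) := by
    refine Summable.of_norm_bounded_eventually_nat
      ((summable_pow_mul_geometric_of_norm_lt_one k hρ1).mul_left
        (2 * Real.exp (-(2 * Real.pi * x)))) ?_
    -- once `exp (2π(x + ns)) ≥ 2`, the bound is at most twice its inverse
    have hlim : Filter.Tendsto (fun n : ℕ => 2 * Real.pi * (x + n * s)) Filter.atTop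
        Filter.atTop :=
      (Filter.tendsto_atTop_add_const_left _ _
        (tendsto_natCast_atTop_atTop.atTop_mul_const hs)).const_mul_atTop hpi
    filter_upwards [(Real.tendsto_exp_atTop.comp hlim).eventually_ge_atTop 2] with n hn
    simp only [Function.comp_apply] at hn
    rw [Real.norm_eq_abs, abs_of_nonneg (mul_nonneg (by positivity) (geomBound_nonneg _))]
    have h1 : geomBound (x + n * s) ≤ 2 * (Real.exp (2 * Real.pi * (x + n * s)))⁻¹ := by
      rw [geomBound, abs_of_pos (by linarith), ← div_eq_mul_inv,
        div_le_div_iff₀ (by linarith) (by linarith)]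
      linarith
    have h2 : (Real.exp (2 * Real.pi * (x + n * s)))⁻¹ = Real.exp (-(2 * Real.pi * x)) * ρ ^ n := by
      rw [hρ, ← Real.exp_nat_mul, ← Real.exp_add, ← Real.exp_neg]
      congr 1
      ring
    rw [h2] at h1
    calc _ ≤ (n : ℝ) ^ k * (2 * (Real.exp (-(2 * Real.pi * x)) * ρ ^ n)) := by gcongr
      _ = _ := by ring
  exact hsum.comp_injective PNat.coe_injective

/-- The Lambert series `∑_{r ≥ 1} rᵏ ζqʳ / (1 - ζqʳ)`. -/
noncomputable def lambertSum (k : ℕ) (p : ℂ × ℂ) : ℂ :=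
  ∑' r : ℕ+, (r : ℂ) ^ k * geomTerm (p.2 + r * p.1)

theorem norm_lambert_term (k : ℕ) (r : ℕ+) (w : ℂ) :
    ‖(r : ℂ) ^ k * geomTerm w‖ = (r : ℝ) ^ k * ‖geomTerm w‖ := by
  rw [norm_mul, norm_pow]
  simp

theorem summable_lambert (k : ℕ) {p : ℂ × ℂ} (hp : p ∈ upperProd) :
    Summable fun r : ℕ+ => (r : ℂ) ^ k * geomTerm (p.2 + r * p.1) := by
  have hp' : 0 < p.1.im := hp
  refine Summable.of_norm_bounded_eventually (summable_geomBound k p.2.im hp') ?_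
  have hlim : Filter.Tendsto (fun n : ℕ => p.2.im + n * p.1.im) Filter.atTop Filter.atTop :=
    Filter.tendsto_atTop_add_const_left _ _ (tendsto_natCast_atTop_atTop.atTop_mul_const hp')
  have h := hlim.eventually_gt_atTop 0
  rw [← Nat.cofinite_eq_atTop] at h
  filter_upwards [PNat.coe_injective.tendsto_cofinite.eventually h] with r hr
  have him : (p.2 + r * p.1).im = p.2.im + r * p.1.im := by simp
  rw [norm_lambert_term, ← him]
  exact mul_le_mul_of_nonneg_left (norm_geomTerm_le (by rw [him]; exact hr.ne')) (by positivity)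

/-- On `Im z > -Im τ` the numbers `ζqʳ` have absolute value less than one. -/
theorem differentiableOn_lambertSum (k : ℕ) :
    DifferentiableOn ℂ (lambertSum k) {p | 0 < p.1.im ∧ 0 < p.2.im + p.1.im} := by
  have c1 : Continuous fun x : ℂ × ℂ => x.1.im := Complex.continuous_im.comp continuous_fst
  have c2 : Continuous fun x : ℂ × ℂ => x.2.im := Complex.continuous_im.comp continuous_snd
  have him : ∀ (r : ℕ+) (p : ℂ × ℂ), (p.2 + r * p.1).im = p.2.im + r * p.1.im := by
    intro r p
    simp
  have hge : ∀ (r : ℕ+) {s : ℝ} {p : ℂ × ℂ}, s ≤ p.1.im → s ≤ p.2.im + p.1.im →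
      r * s ≤ (p.2 + r * p.1).im := by
    intro r s p h1 h2
    rw [him]
    have hr : (1 : ℝ) ≤ r := by exact_mod_cast r.2
    nlinarith
  refine differentiableOn_tsum_of_locally_bounded
    ((isOpen_lt continuous_const c1).inter (isOpen_lt continuous_const (c2.add c1))) ?_ ?_
  · rintro r p ⟨h1, h2⟩
    have hpos : 0 < (p.2 + r * p.1).im :=
      (mul_pos (by exact_mod_cast r.pos : (0 : ℝ) < r) (lt_min h1 h2)).trans_le
        (hge r (min_le_left _ _) (min_le_right _ _))
    have hne : e (p.2 + r * p.1) ≠ 1 := by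
      intro h
      obtain ⟨n, hn⟩ := (e_eq_one_iff _).mp h
      rw [hn] at hpos
      simp at hpos
    have hd : DifferentiableAt ℂ (fun p : ℂ × ℂ => geomTerm (p.2 + r * p.1)) p :=
      DifferentiableAt.comp (f := fun p : ℂ × ℂ => p.2 + r * p.1) p (differentiableAt_geomTerm hne)
        (by fun_prop)
    exact (hd.const_mul _).differentiableWithinAt
  · rintro p ⟨h1, h2⟩
    set s := min p.1.im (p.2.im + p.1.im) / 2 with hs
    have hs0 : 0 < s := half_pos (lt_min h1 h2)
    have hs1 : s < p.1.im := (half_lt_self (lt_min h1 h2)).trans_le (min_le_left _ _)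
    have hs2 : s < p.2.im + p.1.im := (half_lt_self (lt_min h1 h2)).trans_le (min_le_right _ _)
    refine ⟨_, Filter.inter_mem (c1.continuousAt.eventually_const_le hs1)
      ((c2.add c1).continuousAt.eventually_const_le hs2), _, summable_geomBound k 0 hs0, ?_⟩
    rintro r x ⟨hx1, hx2⟩
    have hrs : 0 < (r : ℝ) * s := mul_pos (by exact_mod_cast r.pos) hs0
    have h3 := hge r hx1 hx2
    rw [norm_lambert_term, zero_add]
    exact mul_le_mul_of_nonneg_left
      ((norm_geomTerm_le (hrs.trans_le h3).ne').trans (geomBound_anti hrs h3)) (by positivity)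

/-- Along a line `z = xτ + y` that avoids the poles, the Lambert series are bounded. -/
theorem exists_bound_lambertSum (k : ℕ) {x : ℝ} (hx : ∀ r : ℕ+, x + r ≠ 0) :
    ∃ C : ℝ, ∀ p : ℂ × ℂ, 1 ≤ p.1.im → p.2.im = x * p.1.im → ‖lambertSum k p‖ ≤ C := by
  refine ⟨∑' r : ℕ+, (r : ℝ) ^ k * geomBound (x + r * 1), fun p hp hpx => ?_⟩
  refine tsum_of_norm_bounded (summable_geomBound k x one_pos).hasSum fun r => ?_
  have him : (p.2 + r * p.1).im = (x + r * 1) * p.1.im := by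
    simp [hpx]
    ring
  have hne : x + r * 1 ≠ 0 := by simpa using hx r
  rw [norm_lambert_term]
  refine mul_le_mul_of_nonneg_left ((norm_geomTerm_le ?_).trans ?_) (by positivity)
  · rw [him]
    exact mul_ne_zero hne (by linarith)
  · rw [him]
    exact geomBound_mul_le hne hp

theorem tsum_pnat_shift {f : ℤ → ℂ} (hf : Summable fun r : ℕ+ => f r) :
    ∑' r : ℕ+, f (r + 1) = ∑' r : ℕ+, f r - f 1 := by
  have h : Summable fun n : ℕ => f (n + 1 : ℕ) :=
    (summable_pnat_iff_summable_succ (f := fun n : ℕ => f n)).mp hf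
  rw [tsum_pnat_eq_tsum_succ (f := fun n : ℕ => f (n + 1)),
    tsum_pnat_eq_tsum_succ (f := fun n : ℕ => f n), h.tsum_eq_zero_add]
  simp

theorem geomTerm_add_neg {w : ℂ} (hw : e w ≠ 1) : geomTerm w + geomTerm (-w) = -1 := by
  rw [geomTerm, geomTerm, e_neg]
  have h0 := e_ne_zero w
  have h1 : 1 - e w ≠ 0 := sub_ne_zero.mpr hw.symm
  have h2 : 1 - (e w)⁻¹ = -(1 - e w) / e w := by field_simp; ring
  rw [h2]
  field_simp
  ring

theorem deformedEisenstein_one (τ : ℍ) (z : ℂ) : deformedEisenstein 1 τ z =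
    -geomTerm z - 1 / 2 - lambertSum 0 (τ, z) + lambertSum 0 (τ, -z) := by
  have h1 := summable_lambert 0 (coe_mem_upperProd τ z)
  have h2 := summable_lambert 0 (coe_mem_upperProd τ (-z))
  rw [lambertSum, lambertSum, deformedEisenstein, sub_add, ← h1.tsum_sub h2]
  simp only [geomTerm, e_add, e_neg, ← e_pow, bernoulli_one]
  have h3 : e z / (e z - 1) = -(e z / (1 - e z)) := by rw [← div_neg, neg_sub]
  simp only [if_true, h3, Nat.sub_self, pow_zero, pow_one, one_mul, Nat.cast_one, neg_one_mul,
    ← sub_eq_add_neg]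
  push_cast
  ring

theorem deformedEisenstein_two (τ : ℍ) (z : ℂ) : deformedEisenstein 2 τ z =
    1 / 6 - 2 * (lambertSum 1 (τ, z) + lambertSum 1 (τ, -z)) := by
  have h1 := summable_lambert 1 (coe_mem_upperProd τ z)
  have h2 := summable_lambert 1 (coe_mem_upperProd τ (-z))
  rw [lambertSum, lambertSum, deformedEisenstein, ← h1.tsum_add h2]
  simp only [geomTerm, e_add, e_neg, ← e_pow, bernoulli_two, mul_add]
  norm_num

theorem lambertSum_zero_add (τ : ℍ) (z : ℂ) :
    lambertSum 0 (τ, z + τ) = lambertSum 0 (τ, z) - geomTerm (z + τ) := by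
  have h := summable_lambert 0 (coe_mem_upperProd τ z)
  have h1 := tsum_pnat_shift (f := fun r => geomTerm (z + r * τ)) (by simpa using h)
  simp only [lambertSum, pow_zero, one_mul]
  simp only [Int.cast_add, Int.cast_one, one_mul, Int.cast_natCast] at h1
  rw [← h1]
  refine tsum_congr fun r => ?_
  congr 1
  ring

theorem lambertSum_one_add (τ : ℍ) (z : ℂ) :
    lambertSum 1 (τ, z + τ) = lambertSum 1 (τ, z) - lambertSum 0 (τ, z) := by
  have h := summable_lambert 0 (coe_mem_upperProd τ z)
  have h' := summable_lambert 1 (coe_mem_upperProd τ z)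
  have h1 := tsum_pnat_shift (f := fun r => (r - 1) * geomTerm (z + r * τ))
    ((h'.sub h).congr fun r => by simp; ring)
  rw [lambertSum, lambertSum, lambertSum, ← h'.tsum_sub h]
  simp only [Int.cast_add, Int.cast_one, sub_self, zero_mul, sub_zero, Int.cast_natCast,
    add_sub_cancel_right] at h1
  rw [tsum_congr fun r : ℕ+ => (by simp; ring : (r : ℂ) ^ 1 * geomTerm (z + r * τ) -
    (r : ℂ) ^ 0 * geomTerm (z + r * τ) = (r - 1) * geomTerm (z + r * τ)), ← h1]
  refine tsum_congr fun r => ?_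
  rw [pow_one]
  congr 2
  ring

theorem mem_lattice_of_e_eq_one (τ : ℍ) {z : ℂ} (h : e z = 1) : z ∈ lattice τ := by
  obtain ⟨n, hn⟩ := (e_eq_one_iff z).mp h
  exact ⟨0, n, by simp [hn]⟩

theorem add_mem_lattice_iff (τ : ℍ) (z : ℂ) (l u : ℤ) :
    z + l * τ + u ∈ lattice τ ↔ z ∈ lattice τ := by
  constructor
  · rintro ⟨a, b, h⟩
    exact ⟨a - l, b - u, by push_cast; linear_combination h⟩
  · rintro ⟨a, b, h⟩
    exact ⟨a + l, b + u, by push_cast; linear_combination h⟩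

theorem neg_mem_lattice_iff (τ : ℍ) (z : ℂ) : -z ∈ lattice τ ↔ z ∈ lattice τ := by
  constructor <;> rintro ⟨a, b, h⟩ <;> exact ⟨-a, -b, by push_cast; linear_combination -h⟩

theorem deformedEisenstein_add_int (n : ℕ) (τ : ℍ) (z : ℂ) (u : ℤ) :
    deformedEisenstein n τ (z + u) = deformedEisenstein n τ z := by
  rw [deformedEisenstein, deformedEisenstein, e_add_int]

theorem deformedEisenstein_add_self (τ : ℍ) {z : ℂ} (hz : z ∉ lattice τ) :
    deformedEisenstein 1 τ (z + τ) = deformedEisenstein 1 τ z - 1 ∧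
    deformedEisenstein 2 τ (z + τ) =
      deformedEisenstein 2 τ z - 2 * deformedEisenstein 1 τ z + 1 := by
  have h1 := geomTerm_add_neg (w := z) fun h => hz (mem_lattice_of_e_eq_one τ h)
  have h2 := lambertSum_zero_add τ (-(z + τ))
  have h3 := lambertSum_one_add τ (-(z + τ))
  have h4 : -(z + τ) + τ = -z := by ring
  rw [h4] at h2 h3
  simp only [deformedEisenstein_one, deformedEisenstein_two, lambertSum_zero_add,
    lambertSum_one_add]
  constructor
  · linear_combination h1 - h2
  · linear_combination 2 * h3 + 2 * h2 - 2 * h1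

theorem deformedEisenstein_add_lattice (τ : ℍ) {z : ℂ} (hz : z ∉ lattice τ) (l u : ℤ) :
    deformedEisenstein 1 τ (z + l * τ + u) = deformedEisenstein 1 τ z - l ∧
    deformedEisenstein 2 τ (z + l * τ + u) =
      deformedEisenstein 2 τ z - 2 * l * deformedEisenstein 1 τ z + l ^ 2 := by
  rw [deformedEisenstein_add_int, deformedEisenstein_add_int]
  have hl : ∀ l : ℤ, z + l * τ ∉ lattice τ := fun l h =>
    hz ((add_mem_lattice_iff τ z l 0).mp (by simpa using h))
  induction l with
  | zero => simp
  | succ n ih =>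
    obtain ⟨h1, h2⟩ := deformedEisenstein_add_self τ (hl n)
    have e1 : z + ((n + 1 : ℤ) : ℂ) * τ = z + ((n : ℤ) : ℂ) * τ + τ := by push_cast; ring
    rw [e1, h1, h2, ih.1, ih.2]
    push_cast
    constructor <;> ring
  | pred n ih =>
    obtain ⟨h1, h2⟩ := deformedEisenstein_add_self τ (hl (-n - 1))
    have e1 : z + ((-n - 1 : ℤ) : ℂ) * τ + τ = z + ((-n : ℤ) : ℂ) * τ := by push_cast; ring
    rw [e1, ih.1] at h1
    rw [e1, ih.2] at h2
    push_cast at h1 h2 ⊢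
    constructor
    · linear_combination -h1
    · linear_combination -h2 - 2 * h1

theorem deformedEisenstein_one_neg (τ : ℍ) {z : ℂ} (hz : z ∉ lattice τ) :
    deformedEisenstein 1 τ (-z) = -deformedEisenstein 1 τ z := by
  have h1 := geomTerm_add_neg (w := z) fun h => hz (mem_lattice_of_e_eq_one τ h)
  rw [deformedEisenstein_one, deformedEisenstein_one, neg_neg]
  linear_combination -h1

theorem deformedEisenstein_two_zero (τ : ℍ) :
    deformedEisenstein 2 τ 0 = EisensteinSeries.E2 τ / 6 := by
  have h := tsum_pow_div_one_sub_eq_tsum_sigma (norm_e_lt_one τ) 1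
  have h1 : lambertSum 1 (τ, 0) = ∑' n : ℕ+, (ArithmeticFunction.sigma 1 n : ℂ) * e τ ^ (n : ℕ) := by
    rw [← h, lambertSum]
    refine tsum_congr fun r => ?_
    rw [geomTerm, zero_add, ← e_pow, mul_div_assoc]
  have h2 := EisensteinSeries.E2_eq_tsum_cexp (z := τ)
  rw [deformedEisenstein_two, neg_zero, h1, h2]
  simp only [e]
  ring

/-! ### Doubly periodic functions -/

/-- The real coordinates `(x, y)` of `z = xτ + y`. -/
noncomputable def latticeCoord (τ : ℍ) (z : ℂ) : ℝ × ℝ :=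
  (z.im / τ.im, z.re - z.im / τ.im * τ.re)

theorem continuous_latticeCoord (τ : ℍ) : Continuous (latticeCoord τ) := by
  unfold latticeCoord
  fun_prop

theorem eq_latticeCoord (τ : ℍ) (z : ℂ) :
    z = (latticeCoord τ z).1 * τ + (latticeCoord τ z).2 := by
  have := τ.im_ne_zero
  apply Complex.ext
  · simp [latticeCoord]
  · simp [latticeCoord]
    field_simp

theorem mem_lattice_iff (τ : ℍ) (z : ℂ) : z ∈ lattice τ ↔
    latticeCoord τ z ∈ Set.range ((↑) : ℤ → ℝ) ×ˢ Set.range ((↑) : ℤ → ℝ) := by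
  have := τ.im_ne_zero
  constructor
  · rintro ⟨l, u, rfl⟩
    exact ⟨⟨l, by simp [latticeCoord]; field_simp⟩, ⟨u, by simp [latticeCoord]; field_simp; ring⟩⟩
  · rintro ⟨⟨l, hl⟩, ⟨u, hu⟩⟩
    refine ⟨l, u, ?_⟩
    conv_lhs => rw [eq_latticeCoord τ z, ← hl, ← hu]
    simp

theorem isClosed_lattice (τ : ℍ) : IsClosed (lattice τ) := by
  have h : lattice τ = latticeCoord τ ⁻¹' (Set.range ((↑) : ℤ → ℝ) ×ˢ Set.range ((↑) : ℤ → ℝ)) :=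
    Set.ext fun z => mem_lattice_iff τ z
  rw [h]
  exact (Int.isClosedEmbedding_coe_real.isClosed_range.prod
    Int.isClosedEmbedding_coe_real.isClosed_range).preimage (continuous_latticeCoord τ)

theorem zero_mem_lattice (τ : ℍ) : (0 : ℂ) ∈ lattice τ := ⟨0, 0, by simp⟩

theorem exists_nhds_zero_lattice (τ : ℍ) : ∃ s ∈ nhds (0 : ℂ), ∀ z ∈ s, z ≠ 0 → z ∉ lattice τ := by
  have h0 : latticeCoord τ 0 = (0, 0) := by simp [latticeCoord]
  refine ⟨_, (continuous_latticeCoord τ).continuousAt.preimage_mem_nhds (by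
    rw [h0]; exact prod_mem_nhds (Metric.ball_mem_nhds (0 : ℝ) one_pos)
      (Metric.ball_mem_nhds (0 : ℝ) one_pos)), fun z hz hne hmem => hne ?_⟩
  obtain ⟨⟨l, hl⟩, ⟨u, hu⟩⟩ := (mem_lattice_iff τ z).mp hmem
  obtain ⟨h1, h2⟩ := hz
  rw [← hl, Metric.mem_ball, dist_zero_right, Real.norm_eq_abs] at h1
  rw [← hu, Metric.mem_ball, dist_zero_right, Real.norm_eq_abs] at h2
  have hl0 : l = 0 := Int.abs_lt_one_iff.mp (by exact_mod_cast h1)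
  have hu0 : u = 0 := Int.abs_lt_one_iff.mp (by exact_mod_cast h2)
  rw [eq_latticeCoord τ z, ← hl, ← hu, hl0, hu0]
  simp

theorem eventually_notMem_lattice (τ : ℍ) : ∀ᶠ z in nhdsWithin (0 : ℂ) {0}ᶜ, z ∉ lattice τ := by
  obtain ⟨s, hs, h⟩ := exists_nhds_zero_lattice τ
  filter_upwards [mem_nhdsWithin_of_mem_nhds hs, self_mem_nhdsWithin] with z hz hne
  exact h z hz hne

theorem dense_compl_lattice (τ : ℍ) : Dense (lattice τ)ᶜ := by
  refine Set.Countable.dense_compl ℂ ?_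
  refine (Set.countable_range fun a : ℤ × ℤ => (a.1 * τ + a.2 : ℂ)).mono ?_
  rintro z ⟨l, u, rfl⟩
  exact ⟨(l, u), rfl⟩

/-- An entire function that is periodic under a lattice is bounded by its maximum over a
fundamental parallelogram, hence constant. -/
theorem eq_of_periodic_of_differentiable (τ : ℍ) {g : ℂ → ℂ} (hg : Differentiable ℂ g)
    (hper : ∀ (z : ℂ) (l u : ℤ), g (z + l * τ + u) = g z) (z w : ℂ) : g z = g w := by
  refine hg.apply_eq_apply_of_bounded ?_ z w
  have hK : IsCompact ((fun a : ℝ × ℝ => g (a.1 * τ + a.2)) '' (Set.Icc 0 1 ×ˢ Set.Icc 0 1)) :=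
    (isCompact_Icc.prod isCompact_Icc).image (hg.continuous.comp (by fun_prop))
  refine hK.isBounded.subset ?_
  rintro _ ⟨z, rfl⟩
  set x := (latticeCoord τ z).1 with hx
  set y := (latticeCoord τ z).2 with hy
  refine ⟨(Int.fract x, Int.fract y), ⟨⟨Int.fract_nonneg _, (Int.fract_lt_one _).le⟩,
    ⟨Int.fract_nonneg _, (Int.fract_lt_one _).le⟩⟩, ?_⟩
  have h := hper (Int.fract x * τ + Int.fract y) ⌊x⌋ ⌊y⌋
  simp only [← h]
  congr 1
  have e1 : (x : ℂ) = (⌊x⌋ : ℂ) + (Int.fract x : ℝ) := by exact_mod_cast (Int.floor_add_fract x).symm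
  have e2 : (y : ℂ) = (⌊y⌋ : ℂ) + (Int.fract y : ℝ) := by exact_mod_cast (Int.floor_add_fract y).symm
  rw [eq_latticeCoord τ z, ← hx, ← hy, e1, e2]
  ring

/-- An elliptic function whose only singularities are lattice points, where it has at most a simple
pole with vanishing residue, is constant. -/
theorem exists_const_of_elliptic (τ : ℍ) {f : ℂ → ℂ} (hf : ∀ z ∉ lattice τ, DifferentiableAt ℂ f z)
    (hper : ∀ z ∉ lattice τ, ∀ l u : ℤ, f (z + l * τ + u) = f z)
    (h0 : Filter.Tendsto (fun z => z * f z) (nhdsWithin 0 {0}ᶜ) (nhds 0)) :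
    ∃ C : ℂ, ∀ z ∉ lattice τ, f z = C := by
  classical
  set f₀ := Filter.limUnder (nhdsWithin 0 {0}ᶜ) f with hf₀
  let g : ℂ → ℂ := fun z => if z ∈ lattice τ then f₀ else f z
  have gper : ∀ (z : ℂ) (l u : ℤ), g (z + l * τ + u) = g z := by
    intro z l u
    by_cases hz : z ∈ lattice τ
    · simp only [g, if_pos hz, if_pos ((add_mem_lattice_iff τ z l u).mpr hz)]
    · simp only [g, if_neg hz, if_neg (mt (add_mem_lattice_iff τ z l u).mp hz), hper z hz l u]
  have gzero : DifferentiableAt ℂ g 0 := by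
    obtain ⟨s, hs, h⟩ := exists_nhds_zero_lattice τ
    have hd : DifferentiableOn ℂ f (s \ {0}) := fun z hz =>
      (hf z (h z hz.1 hz.2)).differentiableWithinAt
    have ho : (fun z => f z - f 0) =o[nhdsWithin 0 {0}ᶜ] fun z => (z - 0)⁻¹ := by
      rw [Asymptotics.isLittleO_iff_tendsto']
      · have h1 : Filter.Tendsto (fun z : ℂ => z) (nhdsWithin 0 {0}ᶜ) (nhds 0) :=
          Filter.tendsto_id.mono_left nhdsWithin_le_nhds
        have h2 := h0.sub (h1.mul_const (f 0))
        simp only [zero_mul, sub_zero] at h2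
        refine h2.congr fun z => ?_
        rw [sub_zero, div_inv_eq_mul]
        ring
      · filter_upwards [self_mem_nhdsWithin] with z hz hz'
        rw [sub_zero, inv_eq_zero] at hz'
        exact absurd hz' hz
    have h2 := (Complex.differentiableOn_update_limUnder_of_isLittleO hs hd ho).differentiableAt hs
    refine h2.congr_of_eventuallyEq ?_
    filter_upwards [hs] with z hz
    by_cases hz0 : z = 0
    · subst hz0
      simp [g, zero_mem_lattice τ, hf₀]
    · simp [g, h z hz hz0, hz0]
  have gdiff : Differentiable ℂ g := by
    intro z
    by_cases hz : z ∈ lattice τ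
    · obtain ⟨l, u, hlu⟩ := id hz
      have h1 : g = fun w => g (w - z) := by
        funext w
        rw [← gper (w - z) l u]
        congr 1
        rw [hlu]
        ring
      rw [h1]
      exact DifferentiableAt.comp (g := g) (f := fun w : ℂ => w - z) z (by simpa using gzero)
        (by fun_prop)
    · refine (hf z hz).congr_of_eventuallyEq ?_
      filter_upwards [(isClosed_lattice τ).isOpen_compl.mem_nhds hz] with w hw
      exact if_neg hw
  refine ⟨f₀, fun z hz => ?_⟩
  have := eq_of_periodic_of_differentiable τ gdiff gper z 0
  simpa [g, hz, zero_mem_lattice τ] using this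

/-! ### Modular transformation of the deformed Eisenstein series -/

theorem differentiableAt_lambertSum (k : ℕ) {τ : ℍ} {z : ℂ} (hz : |z.im| < τ.im) :
    DifferentiableAt ℂ (fun w => lambertSum k (τ, w)) z ∧
      DifferentiableAt ℂ (fun w => lambertSum k (τ, -w)) z := by
  have c1 : Continuous fun x : ℂ × ℂ => x.1.im := Complex.continuous_im.comp continuous_fst
  have c2 : Continuous fun x : ℂ × ℂ => x.2.im + x.1.im :=
    (Complex.continuous_im.comp continuous_snd).add c1
  have hopen : IsOpen {p : ℂ × ℂ | 0 < p.1.im ∧ 0 < p.2.im + p.1.im} :=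
    (isOpen_lt continuous_const c1).inter (isOpen_lt continuous_const c2)
  have key : ∀ w : ℂ, |w.im| < τ.im → DifferentiableAt ℂ (lambertSum k) (τ, w) := fun w hw =>
    (differentiableOn_lambertSum k).differentiableAt
      (hopen.mem_nhds ⟨τ.im_pos, by have := abs_lt.mp hw; simp; linarith⟩)
  exact ⟨(key z hz).comp z (f := fun w => ((τ : ℂ), w)) (by fun_prop),
    (key (-z) (by simpa using hz)).comp z (f := fun w => ((τ : ℂ), -w)) (by fun_prop)⟩

theorem differentiableAt_deformedEisenstein (τ : ℍ) {z : ℂ} (hz : z ∉ lattice τ) :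
    DifferentiableAt ℂ (deformedEisenstein 1 τ) z ∧
      DifferentiableAt ℂ (deformedEisenstein 2 τ) z := by
  have strip : ∀ z : ℂ, z ∉ lattice τ → |z.im| < τ.im →
      DifferentiableAt ℂ (deformedEisenstein 1 τ) z ∧
        DifferentiableAt ℂ (deformedEisenstein 2 τ) z := by
    intro z hz him
    rw [funext (deformedEisenstein_one τ), funext (deformedEisenstein_two τ)]
    have h1 := differentiableAt_geomTerm (w := z) fun h => hz (mem_lattice_of_e_eq_one τ h)
    obtain ⟨h2, h3⟩ := differentiableAt_lambertSum 0 him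
    obtain ⟨h4, h5⟩ := differentiableAt_lambertSum 1 him
    exact ⟨((h1.neg.sub_const _).sub h2).add h3, ((h4.add h5).const_mul 2).const_sub _⟩
  set l : ℤ := round (z.im / τ.im) with hl
  have hz' : z - l * τ ∉ lattice τ := fun h =>
    hz (by simpa using (add_mem_lattice_iff τ (z - l * τ) l 0).mpr h)
  have him : |(z - l * τ).im| < τ.im := by
    have h1 := abs_sub_round (z.im / τ.im)
    rw [← hl] at h1
    have h2 : (z - l * τ).im = (z.im / τ.im - l) * τ.im := by
      have := τ.im_ne_zero
      simp
      field_simp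
    rw [h2, abs_mul, abs_of_pos τ.im_pos]
    nlinarith [τ.im_pos]
  obtain ⟨h1, h2⟩ := strip _ hz' him
  have c : DifferentiableAt ℂ (fun w : ℂ => w - l * τ) z := by fun_prop
  have h1' : DifferentiableAt ℂ (fun w => deformedEisenstein 1 τ (w - l * τ)) z :=
    DifferentiableAt.comp (f := fun w : ℂ => w - l * τ) z h1 c
  have h2' : DifferentiableAt ℂ (fun w => deformedEisenstein 2 τ (w - l * τ)) z :=
    DifferentiableAt.comp (f := fun w : ℂ => w - l * τ) z h2 c
  have hev : ∀ᶠ w in nhds z, deformedEisenstein 1 τ w =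
      deformedEisenstein 1 τ (w - l * τ) - l ∧ deformedEisenstein 2 τ w =
      deformedEisenstein 2 τ (w - l * τ) - 2 * l * deformedEisenstein 1 τ (w - l * τ) + l ^ 2 := by
    filter_upwards [(isClosed_lattice τ).isOpen_compl.mem_nhds hz] with w hw
    have := deformedEisenstein_add_lattice τ (z := w - l * τ)
      (fun h => hw (by simpa using (add_mem_lattice_iff τ (w - l * τ) l 0).mpr h)) l 0
    simpa using this
  refine ⟨(h1'.sub_const (l : ℂ)).congr_of_eventuallyEq (hev.mono fun w hw => hw.1), ?_⟩
  exact ((h2'.sub (h1'.const_mul (2 * (l : ℂ)))).add_const ((l : ℂ) ^ 2)).congr_of_eventuallyEq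
    (hev.mono fun w hw => hw.2)

/-- `J₁` has a simple pole with residue `1 / (2πi)` at the origin. -/
theorem tendsto_mul_deformedEisenstein_one (τ : ℍ) :
    Filter.Tendsto (fun z => z * deformedEisenstein 1 τ z) (nhdsWithin 0 {0}ᶜ)
      (nhds (2 * Real.pi * Complex.I)⁻¹) := by
  have hid : Filter.Tendsto (fun z : ℂ => z) (nhdsWithin 0 {0}ᶜ) (nhds 0) :=
    Filter.tendsto_id.mono_left nhdsWithin_le_nhds
  have h1 : Filter.Tendsto (fun z : ℂ => z * geomTerm z) (nhdsWithin 0 {0}ᶜ)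
      (nhds (-(2 * Real.pi * Complex.I)⁻¹)) := by
    have hs := (hasDerivAt_e 0).tendsto_slope
    rw [e_zero, mul_one] at hs
    have he : Filter.Tendsto e (nhdsWithin 0 {0}ᶜ) (nhds 1) := by
      have := continuous_e.tendsto 0
      rw [e_zero] at this
      exact this.mono_left nhdsWithin_le_nhds
    have := (he.mul (hs.inv₀ Complex.two_pi_I_ne_zero)).neg
    rw [one_mul] at this
    refine this.congr fun z => ?_
    rw [slope_def_field, e_zero, geomTerm, sub_zero, inv_div, ← neg_sub (e z) 1, div_neg]
    ring
  obtain ⟨d2, d3⟩ := differentiableAt_lambertSum 0 (τ := τ) (z := 0) (by simpa using τ.im_pos)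
  have h2 := d2.continuousAt.tendsto.mono_left (nhdsWithin_le_nhds (s := {0}ᶜ))
  have h3 := d3.continuousAt.tendsto.mono_left (nhdsWithin_le_nhds (s := {0}ᶜ))
  have h4 := h1.neg.add (hid.mul ((h3.sub h2).sub_const (1 / 2)))
  rw [zero_mul, add_zero, neg_neg] at h4
  refine h4.congr fun z => ?_
  rw [deformedEisenstein_one]
  ring

theorem tendsto_deformedEisenstein_two (τ : ℍ) :
    Filter.Tendsto (deformedEisenstein 2 τ) (nhdsWithin 0 {0}ᶜ)
      (nhds (EisensteinSeries.E2 τ / 6)) := by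
  obtain ⟨h4, h5⟩ := differentiableAt_lambertSum 1 (τ := τ) (z := 0) (by simpa using τ.im_pos)
  have h : ContinuousAt (deformedEisenstein 2 τ) 0 := by
    rw [funext (deformedEisenstein_two τ)]
    exact (((h4.add h5).const_mul 2).const_sub _).continuousAt
  rw [← deformedEisenstein_two_zero]
  exact h.tendsto.mono_left nhdsWithin_le_nhds

theorem coe_smul_eq (γ : SL(2, ℤ)) (τ : ℍ) : ((γ • τ : ℍ) : ℂ) =
    ((γ 0 0 : ℂ) * τ + γ 0 1) / ((γ 1 0 : ℂ) * τ + γ 1 1) := by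
  rw [UpperHalfPlane.coe_specialLinearGroup_apply]
  simp

theorem denom_apply_ne_zero (γ : SL(2, ℤ)) (τ : ℍ) : (γ 1 0 : ℂ) * τ + γ 1 1 ≠ 0 := by
  have := UpperHalfPlane.denom_ne_zero γ τ
  rwa [ModularGroup.denom_apply] at this

theorem det_eq_one (γ : SL(2, ℤ)) : (γ 0 0 : ℂ) * γ 1 1 - γ 0 1 * γ 1 0 = 1 := by
  have := γ.det_coe
  rw [Matrix.det_fin_two] at this
  exact_mod_cast this

/-- The lattice of `γτ` is that of `τ` divided by `cτ + d`. -/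
theorem div_denom_add (γ : SL(2, ℤ)) (τ : ℍ) (z : ℂ) (l u : ℤ) :
    (z + l * τ + u) / ((γ 1 0 : ℂ) * τ + γ 1 1) = z / ((γ 1 0 : ℂ) * τ + γ 1 1) +
      (l * γ 1 1 - u * γ 1 0 : ℤ) * (γ • τ : ℍ) + (u * γ 0 0 - l * γ 0 1 : ℤ) := by
  rw [coe_smul_eq]
  have h := denom_apply_ne_zero γ τ
  have hdet := det_eq_one γ
  push_cast
  generalize (γ 0 0 : ℂ) = a at *
  generalize (γ 0 1 : ℂ) = b at *
  generalize (γ 1 0 : ℂ) = c at *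
  generalize (γ 1 1 : ℂ) = d at *
  obtain ⟨j, hj⟩ : ∃ j, j = c * τ + d := ⟨_, rfl⟩
  rw [← hj] at h ⊢
  field_simp
  linear_combination (-(l * (τ : ℂ)) - u) * hdet - (u * a - l * b) * hj

theorem div_denom_mem_lattice_iff (γ : SL(2, ℤ)) (τ : ℍ) (z : ℂ) :
    z / ((γ 1 0 : ℂ) * τ + γ 1 1) ∈ lattice (γ • τ) ↔ z ∈ lattice τ := by
  have h := denom_apply_ne_zero γ τ
  constructor
  · rintro ⟨l, u, hz⟩
    refine ⟨l * γ 0 0 + u * γ 1 0, l * γ 0 1 + u * γ 1 1, ?_⟩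
    rw [coe_smul_eq, div_eq_iff h] at hz
    rw [hz]
    push_cast
    generalize (γ 0 0 : ℂ) = a at *
    generalize (γ 0 1 : ℂ) = b at *
    generalize (γ 1 0 : ℂ) = c at *
    generalize (γ 1 1 : ℂ) = d at *
    rw [add_mul, mul_assoc, div_mul_cancel₀ _ h]
    ring
  · rintro ⟨l, u, hz⟩
    have := div_denom_add γ τ 0 l u
    rw [zero_add, ← hz, zero_div, zero_add] at this
    exact ⟨_, _, this⟩

theorem E2_smul (γ : SL(2, ℤ)) (τ : ℍ) : EisensteinSeries.E2 (γ • τ) =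
    ((γ 1 0 : ℂ) * τ + γ 1 1) ^ 2 * EisensteinSeries.E2 τ +
      12 * γ 1 0 * ((γ 1 0 : ℂ) * τ + γ 1 1) * (2 * Real.pi * Complex.I)⁻¹ := by
  have h := congrFun (EisensteinSeries.E2_slash_action γ) τ
  rw [ModularForm.SL_slash_apply] at h
  have hd := denom_apply_ne_zero γ τ
  simp only [EisensteinSeries.D2, riemannZeta_two, Pi.sub_apply, Pi.smul_apply, smul_eq_mul,
    ModularGroup.denom_apply] at h
  have hpi : (Real.pi : ℂ) ≠ 0 := by exact_mod_cast Real.pi_ne_zero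
  have hI := Complex.I_ne_zero
  rw [zpow_neg, ← div_eq_mul_inv, div_eq_iff (zpow_ne_zero _ hd)] at h
  rw [h]
  norm_cast
  push_cast
  generalize (γ 1 0 : ℂ) = c at *
  generalize (γ 1 1 : ℂ) = d at *
  field_simp
  linear_combination (-12 * c) * Complex.I_sq

theorem tendsto_div_denom (γ : SL(2, ℤ)) (τ : ℍ) :
    Filter.Tendsto (fun z : ℂ => z / ((γ 1 0 : ℂ) * τ + γ 1 1)) (nhdsWithin 0 {0}ᶜ)
      (nhdsWithin 0 {0}ᶜ) := by
  have h := denom_apply_ne_zero γ τ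
  refine tendsto_nhdsWithin_iff.mpr ⟨?_, ?_⟩
  · have : Continuous fun z : ℂ => z / ((γ 1 0 : ℂ) * τ + γ 1 1) := by fun_prop
    have := this.tendsto 0
    rw [zero_div] at this
    exact this.mono_left nhdsWithin_le_nhds
  · filter_upwards [self_mem_nhdsWithin] with z hz
    exact div_ne_zero hz h

/-- The difference of the two sides is an odd elliptic function without poles. -/
theorem deformedEisenstein_one_smul (γ : SL(2, ℤ)) (τ : ℍ) {z : ℂ} (hz : z ∉ lattice τ) :
    deformedEisenstein 1 (γ • τ) (z / ((γ 1 0 : ℂ) * τ + γ 1 1)) =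
      ((γ 1 0 : ℂ) * τ + γ 1 1) * deformedEisenstein 1 τ z + γ 1 0 * z := by
  have hj := denom_apply_ne_zero γ τ
  set c : ℂ := (γ 1 0 : ℂ) with hc
  set j : ℂ := c * τ + γ 1 1 with hjdef
  have hmem : ∀ w : ℂ, w / j ∈ lattice (γ • τ) ↔ w ∈ lattice τ := div_denom_mem_lattice_iff γ τ
  let f : ℂ → ℂ := fun w => deformedEisenstein 1 (γ • τ) (w / j) -
    j * deformedEisenstein 1 τ w - c * w
  obtain ⟨C, hC⟩ := exists_const_of_elliptic τ (f := f) (by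
    intro w hw
    have h1 : DifferentiableAt ℂ (fun w => deformedEisenstein 1 (γ • τ) (w / j)) w :=
      DifferentiableAt.comp (f := fun w : ℂ => w / j) w
        (differentiableAt_deformedEisenstein _ (mt (hmem w).mp hw)).1 (by fun_prop)
    exact (h1.sub ((differentiableAt_deformedEisenstein τ hw).1.const_mul j)).sub
      (differentiableAt_id.const_mul c)) (by
    intro w hw l u
    have h1 := div_denom_add γ τ w l u
    rw [← hc, ← hjdef] at h1
    simp only [f, h1]
    rw [(deformedEisenstein_add_lattice _ (mt (hmem w).mp hw) _ _).1,
      (deformedEisenstein_add_lattice τ hw l u).1, hjdef]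
    push_cast
    rw [← hc]
    ring) (by
    have h1 := ((tendsto_mul_deformedEisenstein_one (γ • τ)).comp
      (tendsto_div_denom γ τ)).const_mul j
    have h2 := (tendsto_mul_deformedEisenstein_one τ).const_mul j
    have h3 : Filter.Tendsto (fun w : ℂ => c * w ^ 2) (nhdsWithin 0 {0}ᶜ) (nhds 0) := by
      have : Continuous fun w : ℂ => c * w ^ 2 := by fun_prop
      have := this.tendsto 0
      simp only [ne_eq, OfNat.ofNat_ne_zero, not_false_eq_true, zero_pow, mul_zero] at this
      exact this.mono_left nhdsWithin_le_nhds
    have h4 := (h1.sub h2).sub h3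
    rw [sub_self, sub_zero] at h4
    refine h4.congr fun w => ?_
    simp only [Function.comp_apply, f, ← hc, ← hjdef]
    field_simp)
  have h1 := hC z hz
  have h2 := hC (-z) (mt (neg_mem_lattice_iff τ z).mp hz)
  simp only [f, neg_div] at h1 h2
  rw [deformedEisenstein_one_neg _ (mt (hmem z).mp hz), deformedEisenstein_one_neg τ hz] at h2
  linear_combination (h1 - h2) / 2

/-- The difference of the two sides is an elliptic function without poles, which vanishes at the
origin by the transformation law of `E₂`. -/
theorem deformedEisenstein_two_smul (γ : SL(2, ℤ)) (τ : ℍ) {z : ℂ} (hz : z ∉ lattice τ) :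
    deformedEisenstein 2 (γ • τ) (z / ((γ 1 0 : ℂ) * τ + γ 1 1)) =
      ((γ 1 0 : ℂ) * τ + γ 1 1) ^ 2 * deformedEisenstein 2 τ z +
        2 * γ 1 0 * z * ((γ 1 0 : ℂ) * τ + γ 1 1) * deformedEisenstein 1 τ z +
          (γ 1 0 : ℂ) ^ 2 * z ^ 2 := by
  have hj := denom_apply_ne_zero γ τ
  have hJ1 := fun w (hw : w ∉ lattice τ) => deformedEisenstein_one_smul γ τ hw
  have hE2 := E2_smul γ τ
  set c : ℂ := (γ 1 0 : ℂ) with hc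
  set j : ℂ := c * τ + γ 1 1 with hjdef
  have hmem : ∀ w : ℂ, w / j ∈ lattice (γ • τ) ↔ w ∈ lattice τ := div_denom_mem_lattice_iff γ τ
  let f : ℂ → ℂ := fun w => deformedEisenstein 2 (γ • τ) (w / j) -
    j ^ 2 * deformedEisenstein 2 τ w - 2 * c * j * (w * deformedEisenstein 1 τ w) - c ^ 2 * w ^ 2
  have hlim : Filter.Tendsto f (nhdsWithin 0 {0}ᶜ) (nhds 0) := by
    have h1 := (tendsto_deformedEisenstein_two (γ • τ)).comp (tendsto_div_denom γ τ)
    have h2 := (tendsto_deformedEisenstein_two τ).const_mul (j ^ 2)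
    have h3 := (tendsto_mul_deformedEisenstein_one τ).const_mul (2 * c * j)
    have h4 : Filter.Tendsto (fun w : ℂ => c ^ 2 * w ^ 2) (nhdsWithin 0 {0}ᶜ) (nhds 0) := by
      have : Continuous fun w : ℂ => c ^ 2 * w ^ 2 := by fun_prop
      have := this.tendsto 0
      simp only [ne_eq, OfNat.ofNat_ne_zero, not_false_eq_true, zero_pow, mul_zero] at this
      exact this.mono_left nhdsWithin_le_nhds
    have h5 := ((h1.sub h2).sub h3).sub h4
    rw [hE2] at h5
    convert h5 using 2
    · rfl
    · ring
  obtain ⟨C, hC⟩ := exists_const_of_elliptic τ (f := f) (by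
    intro w hw
    have h1 : DifferentiableAt ℂ (fun w => deformedEisenstein 2 (γ • τ) (w / j)) w :=
      DifferentiableAt.comp (f := fun w : ℂ => w / j) w
        (differentiableAt_deformedEisenstein _ (mt (hmem w).mp hw)).2 (by fun_prop)
    obtain ⟨h2, h3⟩ := differentiableAt_deformedEisenstein τ hw
    exact ((h1.sub (h3.const_mul _)).sub ((differentiableAt_id.mul h2).const_mul _)).sub
      ((differentiableAt_id.pow 2).const_mul _)) (by
    intro w hw l u
    have h1 := div_denom_add γ τ w l u
    rw [← hc, ← hjdef] at h1
    simp only [f, h1]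
    rw [(deformedEisenstein_add_lattice _ (mt (hmem w).mp hw) _ _).2,
      (deformedEisenstein_add_lattice τ hw l u).1,
      (deformedEisenstein_add_lattice τ hw l u).2, hJ1 w hw, hjdef]
    push_cast
    rw [← hc]
    ring) (by
    have hid : Filter.Tendsto (fun z : ℂ => z) (nhdsWithin 0 {0}ᶜ) (nhds 0) :=
      Filter.tendsto_id.mono_left nhdsWithin_le_nhds
    simpa using hid.mul hlim)
  have hC0 : C = 0 := by
    refine tendsto_nhds_unique (tendsto_const_nhds.congr' ?_) hlim
    filter_upwards [eventually_notMem_lattice τ] with w hw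
    exact (hC w hw).symm
  have h1 := hC z hz
  rw [hC0] at h1
  simp only [f] at h1
  linear_combination h1

/-! ### Covariance of the Oberdieck derivative -/

/-- Invariance under the Heisenberg part `ℤ²` of the Jacobi group at `(τ, z)`. -/
def EllipticAt (m : ℕ) (φ : ℍ → ℂ → ℂ) (τ : ℍ) (z : ℂ) : Prop :=
  ∀ l u : ℤ, e (m * ((l : ℂ) ^ 2 * τ + 2 * l * z)) * φ τ (z + l * τ + u) = φ τ z

/-- Invariance under the subgroup `SL₂(ℤ)` of the Jacobi group at `(τ, z)`. -/
def ModularAt (k : ℤ) (m : ℕ) (φ : ℍ → ℂ → ℂ) (τ : ℍ) (z : ℂ) : Prop :=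
  ∀ γ : SL(2, ℤ), φ (γ • τ) (z / ((γ 1 0 : ℂ) * τ + γ 1 1)) =
    ((γ 1 0 : ℂ) * τ + γ 1 1) ^ k * e (m * (γ 1 0 * z ^ 2 / ((γ 1 0 : ℂ) * τ + γ 1 1))) * φ τ z

theorem slash_eq_iff {k : ℤ} {m : ℕ} {φ : ℍ → ℂ → ℂ} :
    (∀ (γ : SL(2, ℤ)) (l u : ℤ), slash k m φ γ l u = φ) ↔
      ∀ τ z, EllipticAt m φ τ z ∧ ModularAt k m φ τ z := by
  constructor
  · intro h τ z
    constructor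
    · intro l u
      have := congrFun (congrFun (h 1 l u) τ) z
      simpa [slash] using this
    · intro γ
      have hj := denom_apply_ne_zero γ τ
      have := congrFun (congrFun (h γ 0 0) τ) z
      simp only [slash, Int.cast_zero, zero_mul, add_zero, mul_zero, ne_eq, OfNat.ofNat_ne_zero,
        not_false_eq_true, zero_pow] at this
      rw [← this, mul_neg, e_neg, zpow_neg]
      have h1 := zpow_ne_zero k hj
      have h2 := e_ne_zero (m * (γ 1 0 * z ^ 2 / ((γ 1 0 : ℂ) * τ + γ 1 1)))
      rw [← mul_assoc, mul_mul_mul_comm, mul_inv_cancel₀ h1, mul_inv_cancel₀ h2, one_mul, one_mul]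
  · intro h γ l u
    funext τ z
    have hj := denom_apply_ne_zero γ τ
    have h1 := zpow_ne_zero k hj
    have h2 := e_ne_zero
      (m * (γ 1 0 * (z + l * τ + u) ^ 2 / ((γ 1 0 : ℂ) * τ + γ 1 1)))
    rw [slash, (h τ (z + l * τ + u)).2 γ, ← (h τ z).1 l u, add_assoc, mul_add, e_add, mul_neg, e_neg,
      zpow_neg]
    have gen : ∀ a b c d : ℂ, a ≠ 0 → b ≠ 0 → a⁻¹ * (b⁻¹ * c) * (a * b * d) = c * d := by
      intro a b c d ha hb
      field_simp
    exact gen _ _ _ _ h1 h2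

theorem hasDerivAt_extend {φ : ℍ → ℂ → ℂ} (hφ : IsHolomorphic φ) {α β : ℂ → ℂ} {α' β' t : ℂ}
    (hα : HasDerivAt α α' t) (hβ : HasDerivAt β β' t) (τ : ℍ) (hτ : α t = τ) :
    HasDerivAt (fun s => extend φ (α s, β s))
      (2 * Real.pi * Complex.I * (α' * Dτ φ τ (β t) + β' * Dz φ τ (β t))) t := by
  obtain ⟨h1, h2⟩ := fderiv_extend hφ τ (β t)
  rw [← h2]
  rw [← hτ] at h1 ⊢
  exact h1.hasFDerivAt.comp_hasDerivAt t (f := fun s => (α s, β s)) (hα.prodMk hβ)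

theorem eventually_im_pos (τ : ℍ) : ∀ᶠ s in nhds (τ : ℂ), 0 < s.im :=
  Complex.continuous_im.continuousAt.eventually_const_lt τ.im_pos

/-- Obtained by differentiating the invariance of `φ` under `z ↦ z + lτ + u` in `z` and in `τ`. -/
theorem derivatives_elliptic {φ : ℍ → ℂ → ℂ} {m : ℕ} (hφ : IsHolomorphic φ)
    (h : ∀ τ z, EllipticAt m φ τ z) (τ : ℍ) (z : ℂ) (l u : ℤ) :
    Dz φ τ z = e (m * ((l : ℂ) ^ 2 * τ + 2 * l * z)) *
      (Dz φ τ (z + l * τ + u) + 2 * m * l * φ τ (z + l * τ + u)) ∧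
    Dτ φ τ z = e (m * ((l : ℂ) ^ 2 * τ + 2 * l * z)) *
      (Dτ φ τ (z + l * τ + u) + l * Dz φ τ (z + l * τ + u) +
        m * l ^ 2 * φ τ (z + l * τ + u)) := by
  have hpi := Complex.two_pi_I_ne_zero
  constructor
  · have h1 := hasDerivAt_extend hφ (hasDerivAt_const z (τ : ℂ)) (hasDerivAt_id z) τ rfl
    have h2 := hasDerivAt_extend hφ (hasDerivAt_const z (τ : ℂ))
      (((hasDerivAt_id z).add_const (l * τ : ℂ)).add_const (u : ℂ)) τ rfl
    have h3 := (hasDerivAt_e _).comp z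
      ((((hasDerivAt_id z).const_mul (2 * l : ℂ)).const_add ((l : ℂ) ^ 2 * τ)).const_mul (m : ℂ))
    have h4 := h3.mul h2
    have h5 := h1.unique (h4.congr_of_eventuallyEq (Filter.Eventually.of_forall fun s => by
      simp only [id, extend_coe, Function.comp_apply, Pi.mul_apply]
      exact (h τ s l u).symm))
    simp only [id, extend_coe, Function.comp_apply, zero_mul, one_mul, zero_add, mul_one] at h5
    apply mul_left_cancel₀ hpi
    linear_combination h5
  · have h1 := hasDerivAt_extend hφ (hasDerivAt_id (τ : ℂ)) (hasDerivAt_const (τ : ℂ) z) τ rfl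
    have h2 := hasDerivAt_extend hφ (hasDerivAt_id (τ : ℂ))
      ((((hasDerivAt_id (τ : ℂ)).const_mul (l : ℂ)).const_add z).add_const (u : ℂ)) τ rfl
    have h3 := (hasDerivAt_e _).comp (τ : ℂ)
      ((((hasDerivAt_id (τ : ℂ)).const_mul ((l : ℂ) ^ 2)).add_const (2 * l * z)).const_mul (m : ℂ))
    have h4 := h3.mul h2
    have h5 := h1.unique (h4.congr_of_eventuallyEq (by
      filter_upwards [eventually_im_pos τ] with s hs
      have := h ⟨s, hs⟩ z l u
      rw [← extend_coe φ, ← extend_coe φ] at this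
      exact this.symm))
    simp only [id, extend_coe, Function.comp_apply, zero_mul, one_mul, add_zero, mul_one] at h5
    apply mul_left_cancel₀ hpi
    linear_combination h5

/-- Obtained by differentiating the invariance of `φ` under `γ` in `z` and in `τ`, with
`j = cτ + d` and `A` the factor of automorphy. -/
theorem derivatives_modular {φ : ℍ → ℂ → ℂ} {k : ℤ} {m : ℕ} (hφ : IsHolomorphic φ)
    (h : ∀ τ z, ModularAt k m φ τ z) (γ : SL(2, ℤ)) (τ : ℍ) (z : ℂ) {c j A X Y : ℂ}
    (hc : c = γ 1 0) (hj : j = c * τ + γ 1 1) (hA : A = j ^ k * e (m * (c * z ^ 2 / j)))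
    (hX : X = Dτ φ (γ • τ) (z / j)) (hY : Y = Dz φ (γ • τ) (z / j)) :
    Y = A * (j * Dz φ τ z + 2 * m * c * z * φ τ z) ∧
    X - c * z * Y = A * (j ^ 2 * Dτ φ τ z +
      (k * c * j * (2 * Real.pi * Complex.I)⁻¹ - m * c ^ 2 * z ^ 2) * φ τ z) := by
  have hpi := Complex.two_pi_I_ne_zero
  have hj0 : j ≠ 0 := by rw [hj, hc]; exact denom_apply_ne_zero γ τ
  have hmod := coe_smul_eq γ τ
  have hdet := det_eq_one γ
  rw [← hc] at hmod hdet
  constructor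
  · have h1 := hasDerivAt_extend hφ (hasDerivAt_const z ((γ • τ : ℍ) : ℂ))
      ((hasDerivAt_id z).div_const j) (γ • τ) rfl
    have h2 := hasDerivAt_extend hφ (hasDerivAt_const z (τ : ℂ)) (hasDerivAt_id z) τ rfl
    have h3 := ((hasDerivAt_e _).comp z
      (((((hasDerivAt_id z).pow 2).const_mul c).div_const j).const_mul (m : ℂ))).const_mul (j ^ k)
    have h4 := h3.mul h2
    have h5 := h1.unique (h4.congr_of_eventuallyEq (Filter.Eventually.of_forall fun s => by
      have := h τ s γ
      rw [← hc, ← hj] at this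
      simp only [id, extend_coe, Function.comp_apply, Pi.mul_apply, Pi.pow_apply]
      exact this))
    simp only [id, extend_coe, Function.comp_apply, zero_mul, one_mul, zero_add, mul_one,
      Pi.pow_apply] at h5
    rw [← hY] at h5
    have h6 : 2 * Real.pi * Complex.I * Y = 2 * Real.pi * Complex.I *
        (A * (j * Dz φ τ z + 2 * m * c * z * φ τ z)) := by
      rw [hA]
      field_simp at h5 ⊢
      norm_num at h5 ⊢
      linear_combination h5
    exact mul_left_cancel₀ hpi h6
  · have d1 : HasDerivAt (fun s : ℂ => c * s + γ 1 1) c (τ : ℂ) := by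
      simpa using ((hasDerivAt_id (τ : ℂ)).const_mul c).add_const ((γ 1 1 : ℤ) : ℂ)
    have d2 : HasDerivAt (fun s : ℂ => (γ 0 0 : ℂ) * s + γ 0 1) (γ 0 0 : ℂ) (τ : ℂ) := by
      simpa using ((hasDerivAt_id (τ : ℂ)).const_mul ((γ 0 0 : ℤ) : ℂ)).add_const
        ((γ 0 1 : ℤ) : ℂ)
    have hj0' : c * (τ : ℂ) + γ 1 1 ≠ 0 := hj ▸ hj0
    have d3 := d2.fun_div d1 hj0'
    have d4 := (hasDerivAt_const (τ : ℂ) z).fun_div d1 hj0'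
    have h1 := hasDerivAt_extend hφ d3 d4 (γ • τ) hmod.symm
    have h2 := hasDerivAt_extend hφ (hasDerivAt_id (τ : ℂ)) (hasDerivAt_const (τ : ℂ) z) τ rfl
    have h3 := (hasDerivAt_e _).comp (τ : ℂ)
      (((hasDerivAt_const (τ : ℂ) (c * z ^ 2)).fun_div d1 hj0').const_mul (m : ℂ))
    have h3' := (hasDerivAt_zpow k _ (Or.inl hj0')).comp (τ : ℂ) d1
    have h4 := (h3'.mul h3).mul h2
    have h5 := h1.unique (h4.congr_of_eventuallyEq (by
      filter_upwards [eventually_im_pos τ] with s hs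
      have := h ⟨s, hs⟩ z γ
      rw [← extend_coe φ, ← extend_coe φ, coe_smul_eq, ← hc] at this
      exact this))
    simp only [id, extend_coe, Function.comp_apply, zero_mul, one_mul, add_zero,
      Pi.mul_apply, ← hj] at h5
    rw [← hX, ← hY] at h5
    have h6 : 2 * Real.pi * Complex.I * (X - c * z * Y) = 2 * Real.pi * Complex.I *
        (A * (j ^ 2 * Dτ φ τ z +
          (k * c * j * (2 * Real.pi * Complex.I)⁻¹ - m * c ^ 2 * z ^ 2) * φ τ z)) := by
      have hnum : (γ 0 0 : ℂ) * j - ((γ 0 0 : ℂ) * τ + γ 0 1) * c = 1 := by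
        linear_combination hdet + (γ 0 0 : ℂ) * hj
      rw [hnum, zpow_sub_one₀ hj0] at h5
      rw [hA]
      generalize e (m * (c * z ^ 2 / j)) = E at *
      generalize j ^ k = P at *
      generalize 2 * Real.pi * Complex.I = w at *
      field_simp at h5 ⊢
      linear_combination h5
    exact mul_left_cancel₀ hpi h6

theorem oberdieck_elliptic {φ : ℍ → ℂ → ℂ} {m : ℕ} (hφ : IsHolomorphic φ)
    (h : ∀ τ z, EllipticAt m φ τ z) (k : ℤ) (τ : ℍ) {z : ℂ} (hz : z ∉ lattice τ) :
    EllipticAt m (oberdieck k m φ) τ z := by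
  intro l u
  obtain ⟨h1, h2⟩ := derivatives_elliptic hφ h τ z l u
  obtain ⟨h3, h4⟩ := deformedEisenstein_add_lattice τ hz l u
  have h5 := h τ z l u
  rw [oberdieck, oberdieck, h1, h2, h3, h4, ← h5]
  ring

theorem oberdieck_modular {φ : ℍ → ℂ → ℂ} {k : ℤ} {m : ℕ} (hφ : IsHolomorphic φ)
    (h : ∀ τ z, ModularAt k m φ τ z) (τ : ℍ) {z : ℂ} (hz : z ∉ lattice τ) :
    ModularAt (k + 2) m (oberdieck k m φ) τ z := by
  intro γ
  have hj := denom_apply_ne_zero γ τ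
  obtain ⟨h1, h2⟩ := derivatives_modular hφ h γ τ z rfl rfl rfl rfl rfl
  have h3 := deformedEisenstein_one_smul γ τ hz
  have h4 := deformedEisenstein_two_smul γ τ hz
  have h5 := h τ z γ
  rw [oberdieck, oberdieck, E2_smul, h3, h4, h5, eq_add_of_sub_eq h2, h1, zpow_add₀ hj]
  norm_cast
  push_cast
  ring

/-! ### Extension of the Oberdieck derivative across the lattice -/

/-- The Laurent polynomial `(ζʳ - 1) / (ζ - 1)` in `ζ = e z`. -/
noncomputable def geomQuotient : ℤ → ℂ → ℂ
  | Int.ofNat n, z => ∑ j ∈ Finset.range n, e (j * z)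
  | Int.negSucc n, z => -∑ j ∈ Finset.range (n + 1), e (-(j + 1) * z)

theorem geomQuotient_mul (r : ℤ) (z : ℂ) : geomQuotient r z * (e z - 1) = e (r * z) - 1 := by
  cases r with
  | ofNat n =>
    rw [geomQuotient, Finset.sum_mul]
    have h := Finset.sum_range_sub (fun j : ℕ => e (j * z)) n
    rw [Nat.cast_zero, zero_mul, e_zero] at h
    rw [Int.ofNat_eq_natCast, Int.cast_natCast, ← h]
    refine Finset.sum_congr rfl fun j _ => ?_
    push_cast
    rw [add_mul, one_mul, e_add]
    ring
  | negSucc n =>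
    rw [geomQuotient, neg_mul, Finset.sum_mul, ← Finset.sum_neg_distrib]
    have h := Finset.sum_range_sub (fun j : ℕ => e (-j * z)) (n + 1)
    rw [Nat.cast_zero, neg_zero, zero_mul, e_zero] at h
    rw [Int.cast_negSucc, ← h]
    refine Finset.sum_congr rfl fun j _ => ?_
    have h1 : e (-(j : ℂ) * z) = e (-((j : ℂ) + 1) * z) * e z := by
      rw [← e_add]
      ring_nf
    push_cast
    rw [h1]
    ring

theorem differentiable_geomQuotient (r : ℤ) : Differentiable ℂ (geomQuotient r) := by
  have h : ∀ a : ℂ, Differentiable ℂ fun z => e (a * z) := fun a =>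
    differentiable_e.comp (by fun_prop)
  cases r with
  | ofNat n => exact Differentiable.fun_sum fun j _ => h _
  | negSucc n => exact (Differentiable.fun_sum fun j _ => h _).fun_neg

/-- The exponents of `geomQuotient r` lie between `0` and `r`. -/
theorem norm_geomQuotient_le (r : ℤ) (z : ℂ) :
    ‖geomQuotient r z‖ ≤ |(r : ℝ)| * (1 + weight 0 r 0 z.im) := by
  have key : ∀ s : ℝ, (0 ≤ s ∧ s ≤ r) ∨ (r ≤ s ∧ s ≤ 0) →
      ‖e ((s : ℂ) * z)‖ ≤ 1 + weight 0 r 0 z.im := by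
    intro s hs
    have h1 : ‖e ((s : ℂ) * z)‖ = Real.exp (-(2 * Real.pi * (s * z.im))) := by
      rw [norm_e]
      simp
    have h2 : weight 0 r 0 z.im = Real.exp (-(2 * Real.pi * (r * z.im))) := by
      rw [weight]
      simp
    have hpi := Real.two_pi_pos
    rw [h1, h2]
    have h3 : 0 ≤ s * z.im ∨ r * z.im ≤ s * z.im := by
      rcases le_total 0 z.im with hy | hy <;> rcases hs with ⟨ha, hb⟩ | ⟨ha, hb⟩
      · exact Or.inl (mul_nonneg ha hy)
      · exact Or.inr (mul_le_mul_of_nonneg_right ha hy)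
      · exact Or.inr (mul_le_mul_of_nonpos_right hb hy)
      · exact Or.inl (mul_nonneg_of_nonpos_of_nonpos hb hy)
    rcases h3 with h | h
    · have : Real.exp (-(2 * Real.pi * (s * z.im))) ≤ 1 :=
        Real.exp_le_one_iff.mpr (neg_nonpos.mpr (mul_nonneg hpi.le h))
      linarith [Real.exp_pos (-(2 * Real.pi * (r * z.im)))]
    · have : Real.exp (-(2 * Real.pi * (s * z.im))) ≤ Real.exp (-(2 * Real.pi * (r * z.im))) :=
        Real.exp_le_exp.mpr (neg_le_neg (mul_le_mul_of_nonneg_left h hpi.le))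
      linarith
  cases r with
  | ofNat n =>
    rw [geomQuotient]
    refine (norm_sum_le _ _).trans ((Finset.sum_le_card_nsmul _ _
      (1 + weight 0 (Int.ofNat n) 0 z.im) fun j hj => ?_).trans_eq ?_)
    · have hj' : (j : ℝ) ≤ n := by exact_mod_cast (Finset.mem_range.mp hj).le
      have := key j (Or.inl ⟨by positivity, by simpa using hj'⟩)
      simpa using this
    · simp
      ring
  | negSucc n =>
    rw [geomQuotient, norm_neg]
    refine (norm_sum_le _ _).trans ((Finset.sum_le_card_nsmul _ _
      (1 + weight 0 (Int.negSucc n) 0 z.im) fun j hj => ?_).trans_eq ?_)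
    · have hj' : (j : ℝ) ≤ n := by exact_mod_cast Nat.lt_succ_iff.mp (Finset.mem_range.mp hj)
      have := key (-(j + 1)) (Or.inr ⟨by rw [Int.cast_negSucc]; push_cast; linarith, by
        have : (0 : ℝ) ≤ j := by positivity
        linarith⟩)
      simpa using this
    · rw [Int.cast_negSucc, abs_neg, abs_of_nonneg (by positivity)]
      simp
      ring

/-- The series `∑ r c(n, r) qⁿ (ζʳ - 1) / (ζ - 1)`. -/
noncomputable def quotientSum (c : ℤ → ℤ → ℂ) (p : ℂ × ℂ) : ℂ :=
  ∑' i : ℤ × ℤ, i.2 * c i.1 i.2 * (e (i.1 * p.1) * geomQuotient i.2 p.2)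

theorem norm_quotientSum_term_le (c : ℤ → ℤ → ℂ) (i : ℤ × ℤ) (p : ℂ × ℂ) :
    ‖i.2 * c i.1 i.2 * (e (i.1 * p.1) * geomQuotient i.2 p.2)‖ ≤
      ‖i.2 * (i.2 * c i.1 i.2)‖ * weight i.1 i.2 p.1.im (0 : ℂ).im +
        ‖i.2 * (i.2 * c i.1 i.2)‖ * weight i.1 i.2 p.1.im p.2.im := by
  have h1 : ‖e (i.1 * p.1)‖ = weight i.1 i.2 p.1.im (0 : ℂ).im := by
    rw [norm_e, weight]
    simp
  have h2 : weight i.1 i.2 p.1.im (0 : ℂ).im * weight 0 i.2 0 p.2.im =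
      weight i.1 i.2 p.1.im p.2.im := by
    rw [weight, weight, weight, ← Real.exp_add]
    congr 1
    simp
    ring
  rw [norm_mul, norm_mul (e _), h1, norm_mul (i.2 : ℂ) (_ * _), Complex.norm_intCast, ← h2]
  have h3 := mul_le_mul_of_nonneg_left (norm_geomQuotient_le i.2 p.2)
    (mul_nonneg (norm_nonneg (i.2 * c i.1 i.2)) (weight_pos i.1 i.2 p.1.im (0 : ℂ).im).le)
  linarith

theorem IsSummable.differentiableOn_quotientSum {c : ℤ → ℤ → ℂ} (hc : IsSummable c) :
    DifferentiableOn ℂ (quotientSum c) upperProd := by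
  refine differentiableOn_tsum_of_locally_bounded isOpen_upperProd (fun i => ?_) fun p hp => ?_
  · have h1 : Differentiable ℂ fun p : ℂ × ℂ => e (i.1 * p.1) := differentiable_e.comp (by fun_prop)
    have h2 : Differentiable ℂ fun p : ℂ × ℂ => geomQuotient i.2 p.2 :=
      (differentiable_geomQuotient i.2).comp differentiable_snd
    exact ((h1.mul h2).const_mul _).differentiableOn
  · obtain ⟨V, hV, u, hu, hb⟩ := hc.mul_right.mul_right.locally_bounded hp
    obtain ⟨V', hV', u', hu', hb'⟩ := hc.mul_right.mul_right.locally_bounded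
      (p := (p.1, 0)) hp
    have hcont : ContinuousAt (fun x : ℂ × ℂ => (x.1, (0 : ℂ))) p := by fun_prop
    refine ⟨_, Filter.inter_mem hV (hcont.preimage_mem_nhds hV'), _, hu'.add hu, ?_⟩
    rintro i x ⟨hx, hx'⟩
    exact (norm_quotientSum_term_le c i x).trans (add_le_add (hb' i _ hx') (hb i x hx))

/-- If `∑ r c(n, r) qⁿ ζʳ` vanishes at `z = 0`, its quotient by `ζ - 1` is holomorphic. -/
theorem IsSummable.quotientSum_mul {c : ℤ → ℤ → ℂ} (hc : IsSummable c) {p : ℂ × ℂ}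
    (hp : p ∈ upperProd) (h0 : fourierSum (fun n r => r * c n r) (p.1, 0) = 0) :
    quotientSum c p * (e p.2 - 1) = fourierSum (fun n r => r * c n r) p := by
  have h1 := hc.mul_right.summable hp
  have h2 := hc.mul_right.summable (p := (p.1, 0)) hp
  rw [← sub_zero (fourierSum _ p), ← h0, fourierSum, fourierSum, ← h1.tsum_sub h2, quotientSum,
    ← tsum_mul_right]
  refine tsum_congr fun i => ?_
  rw [mul_assoc, mul_assoc (e _), geomQuotient_mul, monomial, monomial, mul_zero, add_zero, e_add]
  ring

/-- The domain `|Im (z - lτ)| < Im τ`. -/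
def strip (l : ℤ) : Set (ℂ × ℂ) := {p | 0 < p.1.im ∧ |(p.2 - l * p.1).im| < p.1.im}

theorem isOpen_strip (l : ℤ) : IsOpen (strip l) :=
  (isOpen_lt continuous_const (Complex.continuous_im.comp continuous_fst)).inter
    (isOpen_lt (by fun_prop) (Complex.continuous_im.comp continuous_fst))

theorem round_mem_strip (τ : ℍ) (z : ℂ) : ((τ : ℂ), z) ∈ strip (round (z.im / τ.im)) := by
  refine ⟨τ.im_pos, ?_⟩
  have h1 := abs_sub_round (z.im / τ.im)
  have h2 : (z - round (z.im / τ.im) * τ).im = (z.im / τ.im - round (z.im / τ.im)) * τ.im := by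
    have := τ.im_ne_zero
    simp
    field_simp
  rw [h2, abs_mul, abs_of_pos τ.im_pos, UpperHalfPlane.coe_im]
  nlinarith [τ.im_pos]

/-- The formula for the Oberdieck derivative near `z = 0`, with `J₁` split into `ζ / (ζ - 1)` and a
holomorphic part. -/
noncomputable def oberdieckStrip (k : ℤ) (m : ℕ) (c : ℤ → ℤ → ℂ) (p : ℂ × ℂ) : ℂ :=
  fourierSum (fun n r => n * c n r) p
    - (k : ℂ) / 12 * (1 - 24 * lambertSum 1 (p.1, 0)) * fourierSum c p
    - (e p.2 * quotientSum c p +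
      (-1 / 2 - lambertSum 0 p + lambertSum 0 (p.1, -p.2)) * fourierSum (fun n r => r * c n r) p)
    + m * (1 / 6 - 2 * (lambertSum 1 p + lambertSum 1 (p.1, -p.2))) * fourierSum c p

theorem differentiableOn_oberdieckStrip (k : ℤ) (m : ℕ) {c : ℤ → ℤ → ℂ} (hc : IsSummable c) :
    DifferentiableOn ℂ (oberdieckStrip k m c) (strip 0) := by
  have hF : ∀ {c : ℤ → ℤ → ℂ}, IsSummable c → DifferentiableOn ℂ (fourierSum c) (strip 0) :=
    fun hc p hp => (hc.fderiv_fourierSum hp.1).1.differentiableWithinAt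
  have hlam : ∀ (n : ℕ) (f : ℂ × ℂ → ℂ), Differentiable ℂ f → (∀ p, |(f p).im| ≤ |p.2.im|) →
      DifferentiableOn ℂ (fun p => lambertSum n (p.1, f p)) (strip 0) := by
    intro n f hf hle
    refine (differentiableOn_lambertSum n).comp (by fun_prop) fun p hp => ⟨hp.1, ?_⟩
    have h1 : |p.2.im| < p.1.im := by simpa using hp.2
    have h2 := abs_lt.mp ((hle p).trans_lt h1)
    simp only
    linarith
  have l0 : DifferentiableOn ℂ (lambertSum 0) (strip 0) :=
    hlam 0 (fun p => p.2) differentiable_snd fun p => le_rfl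
  have l0' := hlam 0 (fun p => -p.2) differentiable_snd.neg fun p => by simp
  have l1 : DifferentiableOn ℂ (lambertSum 1) (strip 0) :=
    hlam 1 (fun p => p.2) differentiable_snd fun p => le_rfl
  have l1' := hlam 1 (fun p => -p.2) differentiable_snd.neg fun p => by simp
  have l1'' := hlam 1 (fun _ => 0) (differentiable_const _) fun p => by simp
  have he : DifferentiableOn ℂ (fun p : ℂ × ℂ => e p.2) (strip 0) :=
    (differentiable_e.comp differentiable_snd).differentiableOn
  have hq : DifferentiableOn ℂ (quotientSum c) (strip 0) :=
    hc.differentiableOn_quotientSum.mono fun p hp => hp.1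
  have f0 := hF hc
  have f1 := hF hc.mul_left
  have f2 := hF hc.mul_right
  unfold oberdieckStrip
  fun_prop

theorem oberdieckStrip_eq {φ : ℍ → ℂ → ℂ} {c : ℤ → ℤ → ℂ} (hφ : IsHolomorphic φ)
    (hc : HasFourierExpansion φ c) (h0 : ∀ τ, Dz φ τ 0 = 0) (k : ℤ) (m : ℕ) (τ : ℍ) {z : ℂ}
    (hz : z ∉ lattice τ) : oberdieckStrip k m c (τ, z) = oberdieck k m φ τ z := by
  obtain ⟨h1, h2⟩ := hc.derivatives hφ τ z
  have h3 := (hc.derivatives hφ τ 0).2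
  rw [h0] at h3
  have h4 := hc.isSummable.quotientSum_mul (coe_mem_upperProd τ z) h3.symm
  have h5 := deformedEisenstein_two_zero τ
  rw [deformedEisenstein_two, neg_zero] at h5
  have hE2 : EisensteinSeries.E2 τ = 1 - 24 * lambertSum 1 (τ, 0) := by linear_combination -6 * h5
  have h6 : e z - 1 ≠ 0 := sub_ne_zero.mpr fun h => hz (mem_lattice_of_e_eq_one τ h)
  have h7 : e z * quotientSum c (τ, z) = -geomTerm z * Dz φ τ z := by
    rw [h2, ← h4, geomTerm]
    have h8 : 1 - e z ≠ 0 := sub_ne_zero.mpr (sub_ne_zero.mp h6).symm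
    field_simp
    ring
  rw [oberdieck, deformedEisenstein_one, deformedEisenstein_two, oberdieckStrip, hE2, h7, ← h1, ← h2,
    ← hc.eq_fourierSum]
  ring

/-- The translate of `oberdieckStrip` to the domain `strip l`. -/
noncomputable def oberdieckTranslate (k : ℤ) (m : ℕ) (c : ℤ → ℤ → ℂ) (l : ℤ) (p : ℂ × ℂ) : ℂ :=
  e (-(m * (2 * l * p.2 - (l : ℂ) ^ 2 * p.1))) * oberdieckStrip k m c (p.1, p.2 - l * p.1)

theorem differentiableOn_oberdieckTranslate (k : ℤ) (m : ℕ) {c : ℤ → ℤ → ℂ} (hc : IsSummable c)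
    (l : ℤ) : DifferentiableOn ℂ (oberdieckTranslate k m c l) (strip l) := by
  have h1 : Differentiable ℂ fun p : ℂ × ℂ => e (-(m * (2 * l * p.2 - (l : ℂ) ^ 2 * p.1))) :=
    differentiable_e.comp (by fun_prop)
  refine h1.differentiableOn.mul ((differentiableOn_oberdieckStrip k m hc).comp
    (f := fun p : ℂ × ℂ => (p.1, p.2 - l * p.1)) (by fun_prop) fun p hp => ⟨hp.1, ?_⟩)
  simpa using hp.2

/-- Both sides transform in the same way under `z ↦ z + lτ`. -/
theorem oberdieckTranslate_eq {φ : ℍ → ℂ → ℂ} {c : ℤ → ℤ → ℂ} {m : ℕ} (hφ : IsHolomorphic φ)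
    (hell : ∀ τ z, EllipticAt m φ τ z) (hc : HasFourierExpansion φ c) (h0 : ∀ τ, Dz φ τ 0 = 0)
    (k l : ℤ) (τ : ℍ) {z : ℂ} (hz : z ∉ lattice τ) :
    oberdieckTranslate k m c l (τ, z) = oberdieck k m φ τ z := by
  have hz' : z - l * τ ∉ lattice τ := fun h =>
    hz (by simpa using (add_mem_lattice_iff τ (z - l * τ) l 0).mpr h)
  have h := oberdieck_elliptic hφ hell k τ hz' l 0
  rw [oberdieckTranslate, oberdieckStrip_eq hφ hc h0 k m τ hz', ← h, ← mul_assoc, ← e_add,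
    Int.cast_zero, add_zero, sub_add_cancel]
  have h1 : -(m * (2 * l * z - (l : ℂ) ^ 2 * τ)) + m * ((l : ℂ) ^ 2 * τ + 2 * l * (z - l * τ)) =
    0 := by ring
  rw [h1, e_zero, one_mul]

theorem exists_holomorphic_extension {φ : ℍ → ℂ → ℂ} {c : ℤ → ℤ → ℂ} {m : ℕ} (hφ : IsHolomorphic φ)
    (hell : ∀ τ z, EllipticAt m φ τ z) (hc : HasFourierExpansion φ c) (h0 : ∀ τ, Dz φ τ 0 = 0)
    (k : ℤ) : ∃ ψ : ℍ → ℂ → ℂ, IsHolomorphic ψ ∧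
      ∀ (τ : ℍ) (z : ℂ), z ∉ lattice τ → ψ τ z = oberdieck k m φ τ z := by
  let ψ : ℍ → ℂ → ℂ := fun τ z => oberdieckTranslate k m c (round (z.im / τ.im)) (τ, z)
  have hψ : ∀ (l : ℤ) (τ : ℍ) (z : ℂ), ((τ : ℂ), z) ∈ strip l →
      ψ τ z = oberdieckTranslate k m c l (τ, z) := by
    intro l τ z hl
    by_cases hz : z ∈ lattice τ
    · -- the only lattice points in `strip l` are those of the form `lτ + u`
      obtain ⟨a, b, rfl⟩ := hz
      have hτ := τ.im_pos
      have hal : a = l := by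
        have h1 : |((a : ℝ) - l) * τ.im| < 1 * τ.im := by
          have := hl.2
          simp only [UpperHalfPlane.coe_im] at this
          convert this using 2 <;> simp
          ring
        rw [abs_mul, abs_of_pos hτ] at h1
        have h2 := lt_of_mul_lt_mul_right h1 hτ.le
        have h3 : |a - l| < 1 := by exact_mod_cast h2
        exact sub_eq_zero.mp (Int.abs_lt_one_iff.mp h3)
      have h4 : (a * τ + b : ℂ).im / τ.im = a := by
        simp [hτ.ne']
      simp only [ψ, h4, round_intCast]
      rw [hal]
    · simp only [ψ]
      rw [oberdieckTranslate_eq hφ hell hc h0 k _ τ hz, oberdieckTranslate_eq hφ hell hc h0 k l τ hz]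
  refine ⟨ψ, fun p hp => ?_, fun τ z hz => oberdieckTranslate_eq hφ hell hc h0 k _ τ hz⟩
  set l := round (p.2.im / p.1.im) with hl
  have hmem : strip l ∈ nhds p := (isOpen_strip l).mem_nhds (round_mem_strip ⟨p.1, hp⟩ p.2)
  refine DifferentiableAt.differentiableWithinAt ?_
  refine ((differentiableOn_oberdieckTranslate k m hc.isSummable l).differentiableAt
    hmem).congr_of_eventuallyEq ?_
  filter_upwards [hmem] with x hx
  have := hψ l ⟨x.1, hx.1⟩ x.2 hx
  rw [← extend_coe ψ] at this
  exact this

/-! ### Growth and the support of the Fourier coefficients -/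

/-- `4nm - r²` is bounded below on the support of `c`: it is at least `4mδ`. -/
def SupportBound (m : ℕ) (δ : ℝ) (c : ℤ → ℤ → ℂ) : Prop :=
  ∀ n r : ℤ, c n r ≠ 0 → δ ≤ n - (r : ℝ) ^ 2 / (4 * m)

/-- The exponent `n + rx` is at least `δ - mx²` by completing the square. -/
theorem exists_bound_fourierSum {m : ℕ} (hm : 0 < m) {δ : ℝ} {c : ℤ → ℤ → ℂ} (hc : IsSummable c)
    (hs : SupportBound m δ c) (x : ℝ) : ∃ C : ℝ, ∀ p : ℂ × ℂ, 1 ≤ p.1.im → p.2.im = x * p.1.im →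
      ‖fourierSum c p‖ ≤ C * Real.exp (2 * Real.pi * ((m * x ^ 2 - δ) * p.1.im)) := by
  have hm' : (0 : ℝ) < m := by exact_mod_cast hm
  have hpi := Real.two_pi_pos
  refine ⟨(∑' i : ℤ × ℤ, ‖c i.1 i.2‖ * weight i.1 i.2 1 x) *
    Real.exp (2 * Real.pi * (δ - m * x ^ 2)), fun p hp hpx => ?_⟩
  rw [mul_assoc, ← Real.exp_add]
  refine tsum_of_norm_bounded ((hc 1 x one_pos).hasSum.mul_right _) fun i => ?_
  rw [norm_mul, norm_monomial, mul_assoc]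
  by_cases hi : c i.1 i.2 = 0
  · simp [hi]
  refine mul_le_mul_of_nonneg_left ?_ (norm_nonneg _)
  have h1 := hs _ _ hi
  have h2 : δ - m * x ^ 2 ≤ i.1 + i.2 * x := by
    have h3 : (0 : ℝ) ≤ m * (x + i.2 / (2 * m)) ^ 2 := by positivity
    have h4 : (m : ℝ) * (x + i.2 / (2 * m)) ^ 2 =
        m * x ^ 2 + i.2 * x + (i.2 : ℝ) ^ 2 / (4 * m) := by
      field_simp
      ring
    linarith
  rw [weight, weight, ← Real.exp_add, Real.exp_le_exp, hpx]
  nlinarith [mul_nonneg hpi.le (mul_nonneg (sub_nonneg.mpr hp) (sub_nonneg.mpr h2))]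

theorem exists_bound_deformedEisenstein {x : ℝ} (hx : ∀ n : ℤ, x ≠ n) :
    ∃ C₁ C₂ : ℝ, ∀ (τ : ℍ) (z : ℂ), 1 ≤ τ.im → z.im = x * τ.im →
      ‖deformedEisenstein 1 τ z‖ ≤ C₁ ∧ ‖deformedEisenstein 2 τ z‖ ≤ C₂ := by
  have hx1 : ∀ r : ℕ+, x + r ≠ 0 := fun r h => hx (-(r : ℤ)) (by push_cast; linarith)
  have hx2 : ∀ r : ℕ+, -x + r ≠ 0 := fun r h => hx (r : ℤ) (by push_cast; linarith)
  have hx0 : x ≠ 0 := by simpa using hx 0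
  obtain ⟨A, hA⟩ := exists_bound_lambertSum 0 hx1
  obtain ⟨A', hA'⟩ := exists_bound_lambertSum 0 hx2
  obtain ⟨B, hB⟩ := exists_bound_lambertSum 1 hx1
  obtain ⟨B', hB'⟩ := exists_bound_lambertSum 1 hx2
  refine ⟨geomBound x + 1 / 2 + A + A', 1 / 6 + 2 * (B + B'), fun τ z hτ hz => ?_⟩
  have hz' : (-z).im = -x * τ.im := by simp [hz]
  have hg : ‖geomTerm z‖ ≤ geomBound x := by
    refine (norm_geomTerm_le ?_).trans ?_
    · rw [hz]
      exact mul_ne_zero hx0 (by linarith)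
    · rw [hz]
      exact geomBound_mul_le hx0 hτ
  constructor
  · rw [deformedEisenstein_one]
    refine (norm_add_le_of_le (norm_sub_le_of_le (norm_sub_le_of_le ?_ ?_) (hA _ hτ hz))
      (hA' _ hτ hz'))
    · rwa [norm_neg]
    · norm_num
  · rw [deformedEisenstein_two]
    refine norm_sub_le_of_le (by norm_num) ?_
    rw [norm_mul, Complex.norm_ofNat]
    exact mul_le_mul_of_nonneg_left (norm_add_le_of_le (hB _ hτ hz) (hB' _ hτ hz')) two_pos.le

theorem exists_bound_E2 : ∃ C : ℝ, ∀ τ : ℍ, 1 ≤ τ.im → ‖EisensteinSeries.E2 τ‖ ≤ C := by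
  obtain ⟨B, hB⟩ := exists_bound_lambertSum 1 (x := 0) fun r => by simp
  refine ⟨1 + 24 * B, fun τ hτ => ?_⟩
  have h5 := deformedEisenstein_two_zero τ
  rw [deformedEisenstein_two, neg_zero] at h5
  have hE2 : EisensteinSeries.E2 τ = 1 - 24 * lambertSum 1 (τ, 0) := by linear_combination -6 * h5
  rw [hE2]
  refine norm_sub_le_of_le (by simp) ?_
  rw [norm_mul, Complex.norm_ofNat]
  exact mul_le_mul_of_nonneg_left (hB _ hτ (by simp)) (by norm_num)

/-- Along the lines `z = xτ + y` with `x` not an integer, the Oberdieck derivative grows no faster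
than `φ` itself. -/
theorem exists_bound_oberdieck {φ : ℍ → ℂ → ℂ} {c : ℤ → ℤ → ℂ} {m : ℕ} (hm : 0 < m) {δ : ℝ}
    (hφ : IsHolomorphic φ) (hc : HasFourierExpansion φ c) (hs : SupportBound m δ c) (k : ℤ) {x : ℝ}
    (hx : ∀ n : ℤ, x ≠ n) : ∃ C : ℝ, ∀ (τ : ℍ) (z : ℂ), 1 ≤ τ.im → z.im = x * τ.im →
      ‖oberdieck k m φ τ z‖ ≤ C * Real.exp (2 * Real.pi * ((m * x ^ 2 - δ) * τ.im)) := by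
  obtain ⟨A, hA⟩ := exists_bound_fourierSum hm hc.isSummable hs x
  obtain ⟨A₁, hA₁⟩ := exists_bound_fourierSum hm hc.isSummable.mul_left
    (fun n r h => hs n r (right_ne_zero_of_mul h)) x
  obtain ⟨A₂, hA₂⟩ := exists_bound_fourierSum hm hc.isSummable.mul_right
    (fun n r h => hs n r (right_ne_zero_of_mul h)) x
  obtain ⟨B₁, B₂, hB⟩ := exists_bound_deformedEisenstein hx
  obtain ⟨B, hE⟩ := exists_bound_E2
  refine ⟨A₁ + ‖(k : ℂ) / 12‖ * B * A + B₁ * A₂ + m * B₂ * A, fun τ z hτ hz => ?_⟩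
  set E := Real.exp (2 * Real.pi * ((m * x ^ 2 - δ) * τ.im)) with hEdef
  obtain ⟨h1, h2⟩ := hc.derivatives hφ τ z
  have a : ‖φ τ z‖ ≤ A * E := by
    rw [hc.eq_fourierSum]
    exact hA _ hτ hz
  have a₁ : ‖Dτ φ τ z‖ ≤ A₁ * E := by
    rw [h1]
    exact hA₁ _ hτ hz
  have a₂ : ‖Dz φ τ z‖ ≤ A₂ * E := by
    rw [h2]
    exact hA₂ _ hτ hz
  obtain ⟨b₁, b₂⟩ := hB τ z hτ hz
  have b := hE τ hτ
  have B0 : 0 ≤ B := (norm_nonneg _).trans b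
  have B10 : 0 ≤ B₁ := (norm_nonneg _).trans b₁
  have B20 : 0 ≤ B₂ := (norm_nonneg _).trans b₂
  have e1 : (A₁ + ‖(k : ℂ) / 12‖ * B * A + B₁ * A₂ + m * B₂ * A) * E =
      A₁ * E + ‖(k : ℂ) / 12‖ * B * (A * E) + B₁ * (A₂ * E) + m * B₂ * (A * E) := by ring
  rw [e1, oberdieck]
  refine norm_add_le_of_le (norm_sub_le_of_le (norm_sub_le_of_le a₁ ?_) ?_) ?_
  · rw [norm_mul, norm_mul]
    gcongr
  · rw [norm_mul]
    gcongr
  · rw [norm_mul, norm_mul, Complex.norm_natCast]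
    gcongr

/-- If `F(τ, xτ + y)` is `O(exp (2π(mx² - δ) Im τ))` for every `x` that is not an integer, then the
Fourier coefficients of `F` satisfy `n - r² / (4m) ≥ δ`: otherwise, for `x` near `-r / (2m)` the
Cauchy estimate along `z = xτ + y` tends to zero. -/
theorem IsPeriodicHolomorphic.supportBound {F : ℂ × ℂ → ℂ} (hF : IsPeriodicHolomorphic F) {m : ℕ}
    (hm : 0 < m) {δ : ℝ} (h : ∀ x : ℝ, (∀ n : ℤ, x ≠ n) → ∃ C : ℝ, ∀ p : ℂ × ℂ, 1 ≤ p.1.im →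
      p.2.im = x * p.1.im → ‖F p‖ ≤ C * Real.exp (2 * Real.pi * ((m * x ^ 2 - δ) * p.1.im))) :
    SupportBound m δ (coeffs F) := by
  intro n r hne
  by_contra! hlt
  have hm' : (0 : ℝ) < m := by exact_mod_cast hm
  have hpi := Real.two_pi_pos
  obtain ⟨x, hx, hirr⟩ : ∃ x : ℝ, n + r * x + m * x ^ 2 < δ ∧ Irrational x := by
    have hopen : IsOpen {x : ℝ | n + r * x + m * x ^ 2 < δ} :=
      isOpen_lt (by fun_prop) continuous_const
    obtain ⟨x, hx⟩ := dense_irrational.exists_mem_open hopen ⟨-r / (2 * m), by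
      have : (n : ℝ) + r * (-r / (2 * m)) + m * (-r / (2 * m)) ^ 2 = n - (r : ℝ) ^ 2 / (4 * m) := by
        field_simp
        ring
      rwa [Set.mem_ofPred_eq, this]⟩
    exact ⟨x, hx.2, hx.1⟩
  obtain ⟨C, hC⟩ := h x fun n => hirr.ne_int n
  have hlim : Filter.Tendsto
      (fun v : ℝ => C * Real.exp (2 * Real.pi * (n + r * x + m * x ^ 2 - δ) * v)) Filter.atTop
      (nhds 0) := by
    have h1 : 2 * Real.pi * (n + r * x + m * x ^ 2 - δ) < 0 :=
      mul_neg_of_pos_of_neg hpi (by linarith)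
    have h2 := (Real.tendsto_exp_atBot.comp
      (Filter.tendsto_id.const_mul_atTop_of_neg h1)).const_mul C
    rwa [mul_zero] at h2
  have hle : ‖coeffs F n r‖ ≤ 0 := by
    refine ge_of_tendsto hlim ?_
    filter_upwards [Filter.eventually_ge_atTop 1] with v hv
    refine (hF.norm_coeffs_le n r (by linarith : 0 < v) (x * v)
      (C := C * Real.exp (2 * Real.pi * ((m * x ^ 2 - δ) * v))) fun a u => ?_).trans_eq ?_
    · have := hC (a + v * Complex.I, u + (x * v : ℝ) * Complex.I) (by simpa using hv) (by simp)
      simpa using this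
    · rw [mul_assoc, ← Real.exp_add]
      congr 2
      ring
  exact hne (norm_le_zero_iff.mp hle)

/-! ### The Oberdieck derivative of a Jacobi form -/

theorem continuous_of_isHolomorphic {ψ : ℍ → ℂ → ℂ} (h : IsHolomorphic ψ) (τ : ℍ) :
    Continuous (ψ τ) := by
  have h1 : Continuous fun z => extend ψ (τ, z) :=
    h.continuousOn.comp_continuous (f := fun z : ℂ => ((τ : ℂ), z)) (by fun_prop)
      fun z => coe_mem_upperProd τ z
  simpa only [extend_coe] using h1

theorem eq_of_eq_off_lattice (τ : ℍ) {f g : ℂ → ℂ} (hf : Continuous f) (hg : Continuous g)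
    (h : ∀ z ∉ lattice τ, f z = g z) : f = g :=
  Continuous.ext_on (dense_compl_lattice τ) hf hg fun z hz => h z hz

theorem ellipticAt_extension {ψ χ : ℍ → ℂ → ℂ} {m : ℕ} (hψ : IsHolomorphic ψ)
    (h : ∀ τ z, z ∉ lattice τ → ψ τ z = χ τ z) (hχ : ∀ τ z, z ∉ lattice τ → EllipticAt m χ τ z)
    (τ : ℍ) (z : ℂ) : EllipticAt m ψ τ z := by
  intro l u
  have hc := continuous_of_isHolomorphic hψ τ
  refine congrFun (eq_of_eq_off_lattice τ
    (f := fun z => e (m * ((l : ℂ) ^ 2 * τ + 2 * l * z)) * ψ τ (z + l * τ + u)) (g := ψ τ)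
    ((continuous_e.comp (by fun_prop)).mul (hc.comp (by fun_prop))) hc fun z hz => ?_) z
  rw [h τ z hz, h τ _ (mt (add_mem_lattice_iff τ z l u).mp hz)]
  exact hχ τ z hz l u

theorem modularAt_extension {ψ χ : ℍ → ℂ → ℂ} {k : ℤ} {m : ℕ} (hψ : IsHolomorphic ψ)
    (h : ∀ τ z, z ∉ lattice τ → ψ τ z = χ τ z) (hχ : ∀ τ z, z ∉ lattice τ → ModularAt k m χ τ z)
    (τ : ℍ) (z : ℂ) : ModularAt k m ψ τ z := by
  intro γ
  have hc := continuous_of_isHolomorphic hψ τ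
  have hc' := continuous_of_isHolomorphic hψ (γ • τ)
  refine congrFun (eq_of_eq_off_lattice τ
    (f := fun z => ψ (γ • τ) (z / ((γ 1 0 : ℂ) * τ + γ 1 1)))
    (g := fun z => ((γ 1 0 : ℂ) * τ + γ 1 1) ^ k *
      e (m * (γ 1 0 * z ^ 2 / ((γ 1 0 : ℂ) * τ + γ 1 1))) * ψ τ z)
    (hc'.comp (by fun_prop)) ((continuous_const.mul (continuous_e.comp (by fun_prop))).mul hc)
    fun z hz => ?_) z
  rw [h τ z hz, h _ _ (mt (div_denom_mem_lattice_iff γ τ z).mp hz)]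
  exact hχ τ z hz γ

theorem isPeriodicHolomorphic_extend {ψ : ℍ → ℂ → ℂ} {k : ℤ} {m : ℕ} (hψ : IsHolomorphic ψ)
    (hell : ∀ τ z, EllipticAt m ψ τ z) (hmod : ∀ τ z, ModularAt k m ψ τ z) :
    IsPeriodicHolomorphic (extend ψ) where
  differentiableOn := hψ
  add_one_left p hp := by
    have h := hmod ⟨p.1, hp⟩ p.2 ModularGroup.T
    rw [← extend_coe ψ, ← extend_coe ψ, coe_smul_eq] at h
    simpa [ModularGroup.T, e_zero] using h
  add_one_right p hp := by
    have h := hell ⟨p.1, hp⟩ p.2 0 1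
    rw [← extend_coe ψ, ← extend_coe ψ] at h
    simpa [e_zero] using h

/-- A Jacobi form of even weight is even in `z`. -/
theorem Dz_zero_of_even {φ : ℍ → ℂ → ℂ} {k : ℤ} {m : ℕ} (hk : Even k)
    (hmod : ∀ τ z, ModularAt k m φ τ z) (τ : ℍ) : Dz φ τ 0 = 0 := by
  have heven : ∀ z, φ τ (-z) = φ τ z := by
    intro z
    have h := hmod τ z (-1)
    simpa [e_zero, hk.neg_one_zpow, div_neg] using h
  have h1 := deriv_comp_neg (φ τ) 0
  rw [funext heven, neg_zero] at h1
  have h2 : deriv (φ τ) 0 = 0 := self_eq_neg.mp h1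
  rw [Dz, show deriv (fun w => φ τ w) 0 = 0 from h2, mul_zero]

/-- The common core of both cases: the lower bound `δ` on `n - r² / (4m)` passes from the expansion of
`φ` to that of the extension. -/
theorem exists_jacobi_extension {φ : ℍ → ℂ → ℂ} {k : ℤ} {m : ℕ} (hk : Even k) (hm : 0 < m)
    (hφ : IsJacobiForm k m φ) {δ : ℝ} {c : ℤ → ℤ → ℂ} (hc : HasFourierExpansion φ c)
    (hs : SupportBound m δ c) : ∃ ψ : ℍ → ℂ → ℂ,
      (∀ (τ : ℍ) (z : ℂ), z ∉ lattice τ → ψ τ z = oberdieck k m φ τ z) ∧ IsHolomorphic ψ ∧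
      (∀ (γ : SL(2, ℤ)) (l u : ℤ), slash (k + 2) m ψ γ l u = ψ) ∧
      ∃ d : ℤ → ℤ → ℂ, HasFourierExpansion ψ d ∧ SupportBound m δ d := by
  have hinv := slash_eq_iff.mp hφ.slash_eq
  have hell := fun τ z => (hinv τ z).1
  have hmod := fun τ z => (hinv τ z).2
  have hol := hφ.holomorphic
  obtain ⟨ψ, hψ, heq⟩ := exists_holomorphic_extension hol hell hc (Dz_zero_of_even hk hmod) k
  have hell' := ellipticAt_extension hψ heq fun τ z hz => oberdieck_elliptic hol hell k τ hz
  have hmod' := modularAt_extension hψ heq fun τ z hz => oberdieck_modular hol hmod τ hz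
  have hper := isPeriodicHolomorphic_extend hψ hell' hmod'
  refine ⟨ψ, heq, hψ, slash_eq_iff.mpr fun τ z => ⟨hell' τ z, hmod' τ z⟩, coeffs (extend ψ),
    fun τ z => ?_, hper.supportBound hm fun x hx => ?_⟩
  · have h := hper.hasSum (coe_mem_upperProd τ z)
    rw [extend_coe] at h
    refine h.congr_fun fun i => ?_
    rw [monomial_eq, mul_assoc]
  · obtain ⟨C, hC⟩ := exists_bound_oberdieck hm hol hc hs k hx
    refine ⟨C, fun p hp hpx => ?_⟩
    have hpos : 0 < p.1.im := by linarith
    have hz : p.2 ∉ lattice ⟨p.1, hpos⟩ := by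
      rintro ⟨l, u, hlu⟩
      apply hx l
      rw [hlu] at hpx
      have : (l : ℝ) * p.1.im = x * p.1.im := by simpa using hpx
      exact (mul_right_cancel₀ hpos.ne' this).symm
    have h := hC ⟨p.1, hpos⟩ p.2 hp hpx
    rw [← heq _ _ hz, ← extend_coe ψ] at h
    exact h

theorem supportBound_zero_iff {m : ℕ} (hm : 0 < m) (c : ℤ → ℤ → ℂ) :
    SupportBound m 0 c ↔ ∀ n r : ℤ, c n r ≠ 0 → 0 ≤ 4 * n * m - r ^ 2 := by
  have hm' : (0 : ℝ) < m := by exact_mod_cast hm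
  refine forall_congr' fun n => forall_congr' fun r => imp_congr_right fun _ => ?_
  rw [sub_nonneg, div_le_iff₀ (by positivity), sub_nonneg]
  constructor <;> intro h
  · have : (r : ℝ) ^ 2 ≤ 4 * n * m := by linarith
    exact_mod_cast this
  · have : (r : ℝ) ^ 2 ≤ 4 * n * m := by exact_mod_cast h
    linarith

/-- The integer `4nm - r²` is positive if and only if it is at least one. -/
theorem supportBound_pos_iff {m : ℕ} (hm : 0 < m) (c : ℤ → ℤ → ℂ) :
    SupportBound m (1 / (4 * m)) c ↔ ∀ n r : ℤ, c n r ≠ 0 → 0 < 4 * n * m - r ^ 2 := by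
  have hm' : (0 : ℝ) < m := by exact_mod_cast hm
  refine forall_congr' fun n => forall_congr' fun r => imp_congr_right fun _ => ?_
  rw [le_sub_iff_add_le, ← add_div, div_le_iff₀ (by positivity), ← Int.add_one_le_iff]
  constructor <;> intro h
  · have : (0 : ℝ) + 1 ≤ 4 * n * m - r ^ 2 := by linarith
    exact_mod_cast this
  · have : (0 : ℝ) + 1 ≤ 4 * n * m - r ^ 2 := by exact_mod_cast h
    linarith

theorem extension_unique {ψ ψ' : ℍ → ℂ → ℂ} {χ : ℍ → ℂ → ℂ} (hψ : IsHolomorphic ψ)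
    (hψ' : IsHolomorphic ψ') (h : ∀ τ z, z ∉ lattice τ → ψ τ z = χ τ z)
    (h' : ∀ τ z, z ∉ lattice τ → ψ' τ z = χ τ z) : ψ' = ψ :=
  funext fun τ => eq_of_eq_off_lattice τ (continuous_of_isHolomorphic hψ' τ)
    (continuous_of_isHolomorphic hψ τ) fun z hz => (h' τ z hz).trans (h τ z hz).symm

end JacobiForms

theorem mainTheorem1 (k m : ℕ) (hk : 0 < k) (hk_even : Even k) (hm : 0 < m) :
    (∀ φ : ℍ → ℂ → ℂ, JacobiForms.IsJacobiForm k m φ →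
      ∃! ψ : ℍ → ℂ → ℂ, JacobiForms.IsJacobiForm (k + 2) m ψ ∧
        ∀ (τ : ℍ) (z : ℂ), z ∉ JacobiForms.lattice τ →
          ψ τ z = JacobiForms.oberdieck k m φ τ z) ∧
    (∀ φ : ℍ → ℂ → ℂ, JacobiForms.IsJacobiCuspForm k m φ →
      ∃! ψ : ℍ → ℂ → ℂ, JacobiForms.IsJacobiCuspForm (k + 2) m ψ ∧
        ∀ (τ : ℍ) (z : ℂ), z ∉ JacobiForms.lattice τ →
          ψ τ z = JacobiForms.oberdieck k m φ τ z) := by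
  open JacobiForms in
  have hk' : Even (k : ℤ) := by exact_mod_cast hk_even
  have hpos : (0 : ℝ) ≤ 1 / (4 * m) := by positivity
  constructor
  · intro φ hφ
    obtain ⟨c, hc, hs⟩ := hφ.fourier
    obtain ⟨ψ, heq, hol, hslash, d, hd, hsd⟩ :=
      exists_jacobi_extension hk' hm hφ hc ((supportBound_zero_iff hm c).mpr hs)
    refine ⟨ψ, ⟨⟨hol, hslash, d, hd, (supportBound_zero_iff hm d).mp hsd⟩, heq⟩, ?_⟩
    rintro ψ' ⟨h1, h2⟩
    exact extension_unique hol h1.holomorphic heq h2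
  · intro φ hφ
    obtain ⟨c, hc, hs⟩ := hφ.cuspidal
    obtain ⟨ψ, heq, hol, hslash, d, hd, hsd⟩ :=
      exists_jacobi_extension hk' hm hφ.toIsJacobiForm hc ((supportBound_pos_iff hm c).mpr hs)
    have hsd' := (supportBound_pos_iff hm d).mp hsd
    refine ⟨ψ, ⟨⟨⟨hol, hslash, d, hd, fun n r h => (hsd' n r h).le⟩, d, hd, hsd'⟩, heq⟩, ?_⟩
    rintro ψ' ⟨h1, h2⟩
    exact extension_unique hol h1.holomorphic heq h2
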